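/- Let $n\ge 1$, $\mathfrak s=\mathfrak{sl}(n+1)$ over $\mathbb C$, with elementary matrices $e_{i,j}$, put $h_k=e_{k,k}-\frac1{n+1}\sum_{i=1}^{n+1}e_{i,i}$ for $1\le k\le n$, and let $\mathfrak h=\bigoplus_{k=1}^n\mathbb C h_k$ be the Cartan subalgebra of diagonal matrices. Let $\tau$ be the automorphism $x\mapsto -x^{T}$ of $\mathfrak s$, and for $\mathbf b=(b_1,\dots,b_{n+1})\in(\mathbb C^*)^{n+1}$ let $\varphi_{\mathbf b}$ be the automorphism of $\mathfrak s$ with $e_{i,j}\mapsto \frac{b_i}{b_j}e_{i,j}$ and $h_k\mapsto h_k$. Write $F_{\mathbf b}M$ (resp. the $\tau$-twist of $M$) for the module $M$ on which $x$ acts as $\varphi_{\mathbf b}(x)$ (resp. $\tau(x)$). *Nilsson's modules.* For $S\subseteq\{1,\dots,n\}$ and $a\in\mathbb C$, $M_a^S$ is the space $\mathbb C[h_1,\dots,h_n]$ with the following action, where $\sigma_i$ is the automorphism $h_k\mapsto h_k-\delta_{ik}$ and $1\le i\ne j\le n$: $h_k\cdot f=h_kf$; $e_{i,n+1}\cdot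 f=(h_1+\dots+h_n+a)\,p_i\,\sigma_i f$; $e_{n+1,j}\cdot f=-q_j\,\sigma_j^{-1}f$; $e_{i,j}\cdot f=p_iq_j\,\sigma_i\sigma_j^{-1}f$; where $p_i=1$, $q_i=h_i-a$ for $i\in S$ and $p_i=h_i-a-1$, $q_i=1$ for $i\notin S$. *Exponential tensor modules.* Let $\mathcal D(n)$ be the algebra of polynomial differential operators in $t_1,\dots,t_n$, with $\partial_i=\partial/\partial t_i$. For a $\mathcal D(n)$-module $P$ and a $\mathfrak{gl}(n)$-module $V$, with $E_{ij}$ the elementary matrices of $\mathfrak{gl}(n)$, let $T(P,V)$ be the $\mathfrak s$-module $P\otimes V$ with $h_k\mapsto -t_k\partial_k+E_{kk}-1$, $e_{i,j}\mapsto E_{ij}-t_j\partial_i$, $e_{n+1,j}\mapsto -t_j$, $e_{i,n+1}\mapsto -\sum_j\partial_jE_{ij}+\sum_jt_j\partial_j\partial_i-\sum_j\partial_iE_{jj}+(n+1)\partial_i$ (for $1\le i\neq j\le n$ in $e_{i,j}$, all sums over $1\le j\le n$). For $\mathbf c\in\mathbb C^n$ and $S\subseteq\{1,\dots,n\}$ set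 $T(\mathbf c,V,S)=T(P,V)$, where $P$ is the space $e^{\mathbf c\mathbf t}\mathbb C[t_1,\dots,t_n]$, $\mathbf c\mathbf t=\sum_ic_it_i$, with its natural $\mathcal D(n)$-action twisted by the Fourier transform $\psi_S$: $t_i\mapsto\partial_i$, $\partial_i\mapsto-t_i$ for $i\in S$; $t_i\mapsto t_i$, $\partial_i\mapsto\partial_i$ for $i\notin S$. For $a\in\mathbb C$ let $V_a$ be the one-dimensional $\mathfrak{gl}(n)$-module on which $A$ acts as $a\operatorname{tr}A$. **Statement.** (1) For all $S\subseteq\{1,\dots,n\}$, $a\in\mathbb C$ and $\mathbf b\in(\mathbb C^*)^{n+1}$ there is an isomorphism of $\mathfrak s$-modules $$F_{\mathbf b}M_a^S\;\simeq\;T\bigl(\mathbf b_S,\,V_{a+1},\,\{1,\dots,n\}\setminus S\bigr),\qquad (\mathbf b_S)_i=-\frac{b_i}{b_{n+1}}\ (i\in S),\quad(\mathbf b_S)_j=\frac{b_{n+1}}{b_j}\ (j\notin S).$$ (2) Let $M$ be an $\mathfrak s$-module that is $\mathfrak h$-free of rank $1$, i.e. whose restriction to $U(\mathfrak h)$ is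 a free module of rank $1$. Then there are $\mathbf b\in(\mathbb C^*)^n$, $a\in\mathbb C$ and $S\subseteq\{1,\dots,n\}$ such that $M$ is isomorphic to the exponential tensor module $T(\mathbf b,V_a,S)$ or to its $\tau$-twist. -/

import Mathlib

open scoped TensorProduct

attribute [local instance 100] LieRing.ofAssociativeRing

set_option linter.all false

noncomputable section

namespace HFree

/-! ### Representations of complex Lie algebras -/

/-- A module over the complex Lie algebra `L` with underlying space `M`, given as a representation,
that is, a homomorphism of Lie algebras `L → End M`. The twist of `ρ` by an endomorphism `φ` of `L`
is `ρ.comp φ`. -/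
abbrev LieRep (L : Type*) [LieRing L] [LieAlgebra ℂ L] (M : Type*) [AddCommGroup M] [Module ℂ M] :=
  L →ₗ⁅ℂ⁆ Module.End ℂ M
/-- Isomorphism of two modules over the same Lie algebra. -/
def Isomorphic {L : Type*} [LieRing L] [LieAlgebra ℂ L]
    {M : Type*} [AddCommGroup M] [Module ℂ M] {N : Type*} [AddCommGroup N] [Module ℂ N]
    (ρ : LieRep L M) (ρ' : LieRep L N) : Prop :=
  ∃ e : M ≃ₗ[ℂ] N, ∀ (x : L) (m : M), e (ρ x m) = ρ' x (e m)

/-! ### The Lie algebra `sl(n+1)`, its Cartan subalgebra and its automorphisms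

Rows and columns of the matrices in `sl(n+1)` are indexed by `Fin (n+1)`; the indices `1, …, n` are
`Fin.castSucc i` for `i : Fin n`, and the index `n+1` is `Fin.last n`. -/

/-- The Lie algebra `sl(n+1)` over `ℂ`. -/
abbrev Sl (n : ℕ) := LieAlgebra.SpecialLinear.sl (Fin (n + 1)) ℂ
/-- The Lie algebra `gl(n)` over `ℂ`. -/
abbrev Gl (n : ℕ) := Matrix (Fin n) (Fin n) ℂ

theorem trace_eq_zero {n : ℕ} (x : Sl n) : x.val.trace = 0 := by
  have h := x.property
  exact h

theorem mem_sl {n : ℕ} {A : Matrix (Fin (n + 1)) (Fin (n + 1)) ℂ} (h : A.trace = 0) :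
    A ∈ LieAlgebra.SpecialLinear.sl (Fin (n + 1)) ℂ := h

/-- The Cartan subalgebra `𝔥` of diagonal matrices in `sl(n+1)`. -/
def cartan (n : ℕ) : LieSubalgebra ℂ (Sl n) where
  carrier := {x | x.val.IsDiag}
  add_mem' {x y} hx hy := Matrix.IsDiag.add hx hy
  zero_mem' := Matrix.isDiag_zero
  smul_mem' c x hx := Matrix.IsDiag.smul c hx
  lie_mem' {x y} hx hy := by
    change (x.val * y.val - y.val * x.val).IsDiag
    have hx' := Matrix.IsDiag.diagonal_diag hx
    have hy' := Matrix.IsDiag.diagonal_diag hy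
    rw [← hx', ← hy', Matrix.diagonal_mul_diagonal, Matrix.diagonal_mul_diagonal]
    exact (Matrix.isDiag_diagonal _).sub (Matrix.isDiag_diagonal _)

/-- `M` is an `𝔥`-free `sl(n+1)`-module of rank `r`: its restriction to the universal enveloping
algebra `U(𝔥)` is a free module with a basis of `r` elements. -/
def IsHFreeOfRank {n : ℕ} (r : ℕ) {M : Type*} [AddCommGroup M] [Module ℂ M]
    (ρ : LieRep (Sl n) M) : Prop :=
  letI : Module (UniversalEnvelopingAlgebra ℂ (cartan n)) M :=
    Module.compHom M
      (UniversalEnvelopingAlgebra.lift ℂ (ρ.comp (cartan n).incl)).toRingHom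
  Nonempty (Module.Basis (Fin r) (UniversalEnvelopingAlgebra ℂ (cartan n)) M)

/-- The automorphism `τ` of `sl(n+1)`, the negative transpose `x ↦ -xᵀ`. -/
def tau (n : ℕ) : Sl n →ₗ⁅ℂ⁆ Sl n where
  toFun x := ⟨-x.val.transpose, mem_sl (by
    rw [Matrix.trace_neg, Matrix.trace_transpose, trace_eq_zero, neg_zero])⟩
  map_add' x y := by
    apply Subtype.ext
    change -(x.val + y.val).transpose = -x.val.transpose + -y.val.transpose
    rw [Matrix.transpose_add, neg_add]
  map_smul' c x := by
    apply Subtype.ext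
    change -(c • x.val).transpose = c • -x.val.transpose
    rw [Matrix.transpose_smul, smul_neg]
  map_lie' {x y} := by
    apply Subtype.ext
    change -(x.val * y.val - y.val * x.val).transpose
      = -x.val.transpose * -y.val.transpose - -y.val.transpose * -x.val.transpose
    rw [Matrix.transpose_sub, Matrix.transpose_mul, Matrix.transpose_mul, neg_mul_neg, neg_mul_neg,
      neg_sub]

/-- The automorphism `φ_b` of `sl(n+1)` for `b ∈ (ℂ^*)^(n+1)`, which sends the elementary matrix
`e_{ij}` to `(b_i / b_j) e_{ij}`. -/
def phi {n : ℕ} (b : Fin (n + 1) → ℂˣ) : Sl n →ₗ⁅ℂ⁆ Sl n where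
  toFun x := ⟨Matrix.of fun i j => (b i : ℂ) / (b j : ℂ) * x.val i j, mem_sl (by
    have h := trace_eq_zero x
    simp only [Matrix.trace, Matrix.diag_apply] at h
    simpa [Matrix.trace] using h)⟩
  map_add' x y := by
    apply Subtype.ext
    ext i j
    simp [mul_add]
  map_smul' c x := by
    apply Subtype.ext
    ext i j
    simp [mul_left_comm]
  map_lie' {x y} := by
    apply Subtype.ext
    ext i j
    simp only [LieSubalgebra.coe_bracket, Ring.lie_def, Matrix.sub_apply, Matrix.mul_apply,
      Matrix.of_apply, mul_sub, Finset.mul_sum]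
    congr 1 <;> refine Finset.sum_congr rfl fun k _ => ?_ <;>
    · have := (b k).ne_zero
      have := (b j).ne_zero
      field_simp

/-! ### `sl(n+1)`-modules from the action of the standard basis -/

section Relations

variable {n : ℕ} {R : Type*} [Ring R]

/-- The commutation relations of the elements `h_k = e_{kk} - (1/(n+1)) I`, `e_{ij}`, `e_{i,n+1}`,
`e_{n+1,j}` (`1 ≤ i, j, k ≤ n`, `i ≠ j`) of `sl(n+1)`. Here `X k k` stands for `h_k`, `X i j` with
`i ≠ j` for `e_{ij}`, `U i` for `e_{i,n+1}` and `L j` for `e_{n+1,j}`. -/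
structure SlRelations (X : Fin n → Fin n → R) (U L : Fin n → R) : Prop where
  XX : ∀ i j k l, ⁅X i j, X k l⁆ = (if j = k then X i l else 0) - (if l = i then X k j else 0)
  XU : ∀ i j k, ⁅X i j, U k⁆ = if j = k then U i else 0
  XL : ∀ i j k, ⁅X i j, L k⁆ = -(if k = i then L j else 0)
  UU : ∀ i k, ⁅U i, U k⁆ = 0
  LL : ∀ j l, ⁅L j, L l⁆ = 0
  UL : ∀ i j, ⁅U i, L j⁆ = X i j + (if i = j then ∑ k, X k k else 0)

/-- The images of all elementary matrices of `gl(n+1)` under the extension of such a map to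
`gl(n+1)` by zero on the identity matrix. -/
def fullGen (X : Fin n → Fin n → R) (U L : Fin n → R) : Fin (n + 1) → Fin (n + 1) → R :=
  fun i j => Fin.lastCases (Fin.lastCases (-∑ k, X k k) (fun j => L j) j)
    (fun i => Fin.lastCases (U i) (fun j => X i j) j) i

theorem fullGen_lie {X : Fin n → Fin n → R} {U L : Fin n → R} (h : SlRelations X U L)
    (i j k l : Fin (n + 1)) :
    ⁅fullGen X U L i j, fullGen X U L k l⁆ = (if j = k then fullGen X U L i l else 0)
      - (if l = i then fullGen X U L k j else 0) := by
  have hZX : ∀ k l, ⁅∑ m, X m m, X k l⁆ = 0 := by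
    intro k l
    simp [sum_lie, h.XX]
  have hXZ : ∀ k l, ⁅X k l, ∑ m, X m m⁆ = 0 := by
    intro k l
    rw [← lie_skew, hZX, neg_zero]
  have hZU : ∀ k, ⁅∑ m, X m m, U k⁆ = U k := by
    intro k
    simp [sum_lie, h.XU]
  have hUZ : ∀ k, ⁅U k, ∑ m, X m m⁆ = -U k := by
    intro k
    rw [← lie_skew, hZU]
  have hZL : ∀ k, ⁅∑ m, X m m, L k⁆ = -L k := by
    intro k
    simp [sum_lie, h.XL]
  have hLZ : ∀ k, ⁅L k, ∑ m, X m m⁆ = L k := by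
    intro k
    rw [← lie_skew, hZL, neg_neg]
  have hUX : ∀ i j k, ⁅U k, X i j⁆ = -if j = k then U i else 0 := by
    intro i j k
    rw [← lie_skew, h.XU]
  have hLX : ∀ i j k, ⁅L k, X i j⁆ = if k = i then L j else 0 := by
    intro i j k
    rw [← lie_skew, h.XL, neg_neg]
  have hLU : ∀ i j, ⁅L j, U i⁆ = -(X i j + (if i = j then ∑ k, X k k else 0)) := by
    intro i j
    rw [← lie_skew, h.UL]
  have hc : ∀ i : Fin n, Fin.last n ≠ i.castSucc := fun i => (Fin.castSucc_ne_last i).symm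
  have hc' : ∀ i : Fin n, i.castSucc ≠ Fin.last n := fun i => (Fin.castSucc_ne_last i)
  refine Fin.lastCases ?_ (fun i => ?_) i <;> refine Fin.lastCases ?_ (fun j => ?_) j <;>
  refine Fin.lastCases ?_ (fun k => ?_) k <;> refine Fin.lastCases ?_ (fun l => ?_) l <;>
  simp only [fullGen, Fin.lastCases_castSucc, Fin.lastCases_last, neg_lie, lie_neg, hZX, hXZ, hZU,
    hUZ, hZL, hLZ, hUX, hLX, hLU, h.XX, h.XU, h.XL, h.UU, h.LL, h.UL, Fin.castSucc_inj, hc, hc',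
    if_true, if_false, lie_self, neg_neg, neg_zero, sub_zero, zero_sub, sub_self]
  all_goals first
    | done
    | (split_ifs <;> simp_all <;> abel)

/-- The defining relations of the algebra `𝒟(n)` of polynomial differential operators, for `t i`
(multiplication by the `i`-th variable) and `d i` (the `i`-th partial derivative). -/
structure WeylRelations (t d : Fin n → R) : Prop where
  tt : ∀ i j, ⁅t i, t j⁆ = 0
  dd : ∀ i j, ⁅d i, d j⁆ = 0
  dt : ∀ i j, ⁅d i, t j⁆ = if i = j then 1 else 0

/-- The commutation relations of the elementary matrices of `gl(n)`. -/
structure GlRelations (E : Fin n → Fin n → R) : Prop where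
  EE : ∀ i j k l, ⁅E i j, E k l⁆ = (if j = k then E i l else 0) - (if l = i then E k j else 0)

/-- The images of `h_i` (for `i = j`) and of `e_{ij}` (for `i ≠ j`) under `ω_V`, that is,
`h_k ↦ -t_k ∂_k + E_{kk} - 1` and `e_{ij} ↦ E_{ij} - t_j ∂_i`. -/
def tensorX (t d : Fin n → R) (E : Fin n → Fin n → R) (i j : Fin n) : R :=
  E i j - t j * d i - if i = j then 1 else 0

/-- The image of `e_{i,n+1}` under `ω_V`, that is,
`-∑_j ∂_j E_{ij} + ∑_j t_j ∂_j ∂_i - ∑_j ∂_i E_{jj} + (n+1) ∂_i`. -/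
def tensorU (t d : Fin n → R) (E : Fin n → Fin n → R) (i : Fin n) : R :=
  -(∑ j, d j * E i j) + (∑ j, t j * d j * d i) - (∑ j, d i * E j j) + ((n : R) + 1) * d i

/-- The image of `e_{n+1,j}` under `ω_V`, that is, `-t_j`. -/
def tensorL (t : Fin n → R) (j : Fin n) : R := -t j

theorem tensor_slRelations {t d : Fin n → R} {E : Fin n → Fin n → R} (h : WeylRelations t d)
    (hE : GlRelations E) (htE : ∀ i j k, ⁅t i, E j k⁆ = 0) (hdE : ∀ i j k, ⁅d i, E j k⁆ = 0) :
    SlRelations (tensorX t d E) (tensorU t d E) (tensorL t) := by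
  have lm : ∀ a b c : R, ⁅a, b * c⁆ = ⁅a, b⁆ * c + b * ⁅a, c⁆ := by
    intro a b c; simp only [Ring.lie_def]; noncomm_ring
  have ml : ∀ a b c : R, ⁅a * b, c⁆ = a * ⁅b, c⁆ + ⁅a, c⁆ * b := by
    intro a b c; simp only [Ring.lie_def]; noncomm_ring
  have l1 : ∀ a : R, ⁅a, (1 : R)⁆ = 0 := by intro a; simp [Ring.lie_def]
  have l1' : ∀ a : R, ⁅(1 : R), a⁆ = 0 := by intro a; simp [Ring.lie_def]
  have ln : ∀ a : R, ⁅a, (n : R)⁆ = 0 := by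
    intro a; rw [Ring.lie_def, Nat.cast_comm, sub_self]
  have ln' : ∀ a : R, ⁅(n : R), a⁆ = 0 := by
    intro a; rw [Ring.lie_def, Nat.cast_comm, sub_self]
  have hEt : ∀ i j k, ⁅E j k, t i⁆ = 0 := by
    intro i j k; rw [← lie_skew, htE, neg_zero]
  have hEd : ∀ i j k, ⁅E j k, d i⁆ = 0 := by
    intro i j k; rw [← lie_skew, hdE, neg_zero]
  have htd : ∀ i j, ⁅t j, d i⁆ = -if i = j then 1 else 0 := by
    intro i j; rw [← lie_skew, h.dt]
  have il : ∀ (p : Prop) [Decidable p] (a b : R), ⁅(if p then a else 0), b⁆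
      = if p then ⁅a, b⁆ else 0 := by intro p _ a b; split_ifs <;> simp
  have li : ∀ (p : Prop) [Decidable p] (a b : R), ⁅b, (if p then a else 0)⁆
      = if p then ⁅b, a⁆ else 0 := by intro p _ a b; split_ifs <;> simp
  have cdd : ∀ i j, d i * d j = d j * d i := fun i j => sub_eq_zero.1 (h.dd i j)
  have cdE : ∀ i j k, d i * E j k = E j k * d i := fun i j k => sub_eq_zero.1 (hdE i j k)
  set Eu : R := (∑ j, t j * d j) - (∑ j, E j j) + ((n : R) + 1) with hEu
  set W : Fin n → R := fun i => ∑ j, d j * E i j with hW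
  have hU : ∀ i, tensorU t d E i = Eu * d i - W i := by
    intro i
    simp only [tensorU, hEu, hW, add_mul, sub_mul, Finset.sum_mul, cdE]
    abel
  have hEud : ∀ k, ⁅Eu, d k⁆ = -d k := by
    intro k
    simp [hEu, sum_lie, ml, h.dd, htd, hEd, l1', ln']
  have hEut : ∀ k, ⁅Eu, t k⁆ = t k := by
    intro k
    simp [hEu, sum_lie, ml, h.tt, h.dt, hEt, l1', ln']
  have hEuE : ∀ k l, ⁅Eu, E k l⁆ = 0 := by
    intro k l
    simp [hEu, sum_lie, ml, htE, hdE, hE.EE, l1', ln']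
  have hEuW : ∀ k, ⁅Eu, W k⁆ = -W k := by
    intro k
    simp [hW, lie_sum, lm, hEuE, hEud]
  have hdW : ∀ i k, ⁅d i, W k⁆ = 0 := by
    intro i k
    simp [hW, lie_sum, lm, hdE, h.dd]
  have hWt : ∀ i k, ⁅W i, t k⁆ = E i k := by
    intro i k
    simp [hW, sum_lie, ml, hEt, h.dt]
  have hWW : ∀ i k, ⁅W i, W k⁆ = d k * W i - d i * W k := by
    intro i k
    simp only [hW, lie_sum, sum_lie, lm, ml, hEd, h.dd, hdE, hE.EE, mul_zero, zero_mul, add_zero,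
      Finset.sum_const_zero, zero_add, mul_sub, mul_ite, Finset.sum_sub_distrib, Finset.sum_ite_eq',
      Finset.mem_univ, if_true, Finset.sum_ite_irrel, Finset.sum_ite_eq, Finset.mul_sum]
    simp only [← mul_assoc, cdd _ k, cdd _ i]
  have hsumX : ∑ k, tensorX t d E k k = 1 - Eu := by
    simp [tensorX, hEu]
    abel
  have hdEu : ∀ k, ⁅d k, Eu⁆ = d k := by
    intro k; rw [← lie_skew, hEud, neg_neg]
  have htEu : ∀ k, ⁅t k, Eu⁆ = -t k := by
    intro k; rw [← lie_skew, hEut]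
  have hEEu : ∀ i j, ⁅E i j, Eu⁆ = 0 := by
    intro i j; rw [← lie_skew, hEuE, neg_zero]
  have htW : ∀ i k, ⁅t k, W i⁆ = -E i k := by
    intro i k; rw [← lie_skew, hWt]
  have hEW : ∀ i j k, ⁅E i j, W k⁆ = (if j = k then W i else 0) - d i * E k j := by
    intro i j k
    simp only [hW, lie_sum, lm, hEd, hE.EE, zero_mul, add_zero, zero_add, mul_sub, mul_ite,
      mul_zero, Finset.sum_sub_distrib, Finset.sum_ite_irrel, Finset.sum_const_zero,
      Finset.sum_ite_eq', Finset.mem_univ, if_true]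
  refine ⟨?_, ?_, ?_, ?_, ?_, ?_⟩
  · intro i j k l
    simp only [tensorX, lie_sub, sub_lie, lm, ml, hEd, hEt, h.dd, h.tt, h.dt, htd, hE.EE, htE, hdE,
      il, li, l1, l1']
    by_cases h1 : j = k <;> by_cases h2 : l = i
    · subst h1; subst h2; simp; abel
    · subst h1; simp [h2, Ne.symm h2]
    · subst h2; simp [h1, Ne.symm h1]; abel
    · simp [h1, h2, Ne.symm h1, Ne.symm h2]
  · intro i j k
    rw [hU, hU]
    simp only [tensorX, lie_sub, sub_lie, lm, ml, il, l1', hEEu, hdEu, htEu, hEd, h.dd, htd, hEW, hdW,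
      htW]
    by_cases h1 : j = k
    · subst h1; simp [cdE]
    · simp [h1, Ne.symm h1, cdE]
  · intro i j k
    simp only [tensorX, tensorL, lie_neg, lie_sub, sub_lie, lm, ml, il, l1', hEt, h.tt, h.dt]
    by_cases h1 : k = i
    · subst h1; simp
    · simp [h1, Ne.symm h1]
  · intro i k
    have hWd : ∀ i k, ⁅W k, d i⁆ = 0 := by
      intro i k; rw [← lie_skew, hdW, neg_zero]
    have hWEu : ∀ k, ⁅W k, Eu⁆ = W k := by
      intro k; rw [← lie_skew, hEuW, neg_neg]
    have c1 : ∀ i k, W k * d i = d i * W k := fun i k => (sub_eq_zero.1 (hdW i k)).symm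
    rw [hU, hU]
    simp only [lie_sub, sub_lie, lm, ml, hWW, hdW, hEud, hEuW, h.dd, hWd, hWEu, hdEu, lie_self,
      zero_mul, mul_zero, zero_add, add_zero, neg_mul, mul_neg, neg_neg, sub_mul, c1, mul_assoc, cdd k i]
    rw [sub_zero, mul_neg]
    abel
  · intro j l
    simp [tensorL, h.tt]
  · intro i j
    rw [hU, hsumX]
    simp only [tensorL, lie_neg, sub_lie, ml, hWt, hEut, h.dt, tensorX]
    split_ifs <;> simp <;> abel

end Relations

section Generators

variable {n : ℕ} {R : Type*} [Ring R] [Algebra ℂ R]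

/-- The linear map on `sl(n+1)` with `h_k ↦ X k k`, `e_{ij} ↦ X i j` for `i ≠ j`,
`e_{i,n+1} ↦ U i`, `e_{n+1,j} ↦ L j` (`1 ≤ i, j, k ≤ n`). The coefficient of `h_k` in a matrix `x`
of trace zero is `x_{kk} - x_{n+1,n+1}`. -/
def slMap (X : Fin n → Fin n → R) (U L : Fin n → R) : Sl n →ₗ[ℂ] R where
  toFun x :=
    (∑ i : Fin n, ∑ j : Fin n,
      (x.val i.castSucc j.castSucc - if i = j then x.val (Fin.last n) (Fin.last n) else 0) • X i j)
    + (∑ i : Fin n, x.val i.castSucc (Fin.last n) • U i)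
    + ∑ j : Fin n, x.val (Fin.last n) j.castSucc • L j
  map_add' x y := by
    have h : ∀ (i j : Fin n) (a b : ℂ), (if i = j then a + b else 0)
        = (if i = j then a else 0) + (if i = j then b else 0) := by
      intro i j a b; split_ifs <;> simp
    have hv : (x + y).val = x.val + y.val := rfl
    simp only [hv, Matrix.add_apply, h, add_sub_add_comm, add_smul,
      Finset.sum_add_distrib]
    abel
  map_smul' c x := by
    have h : ∀ (i j : Fin n) (a b : ℂ), (if i = j then a * b else 0)
        = a * (if i = j then b else 0) := by
      intro i j a b; split_ifs <;> simp
    have hv : (c • x).val = c • x.val := rfl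
    simp only [hv, Matrix.smul_apply, smul_eq_mul, h, ← mul_sub, mul_smul,
      ← Finset.smul_sum, ← smul_add, RingHom.id_apply]

theorem slMap_eq (X : Fin n → Fin n → R) (U L : Fin n → R) (x : Sl n) :
    slMap X U L x = ∑ i, ∑ j, x.val i j • fullGen X U L i j := by
  have h : ∀ (i j : Fin n) (a : ℂ), (if i = j then a else 0) • X i j
        = if i = j then a • X i j else 0 := by
      intro i j a; split_ifs <;> simp
  simp only [slMap, LinearMap.coe_mk, AddHom.coe_mk, Fin.sum_univ_castSucc, fullGen,
    Fin.lastCases_castSucc, Fin.lastCases_last, Finset.sum_add_distrib, sub_smul,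
    Finset.sum_sub_distrib, h, Finset.sum_ite_eq, Finset.mem_univ, if_true, smul_neg,
    Finset.smul_sum]
  abel

/-- The homomorphism of Lie algebras `slMap` given by elements that satisfy the relations of
`sl(n+1)`. -/
def slHom (X : Fin n → Fin n → R) (U L : Fin n → R) (h : SlRelations X U L) : Sl n →ₗ⁅ℂ⁆ R where
  toLinearMap := slMap X U L
  map_lie' {x y} := by
    change slMap X U L ⁅x, y⁆ = ⁅slMap X U L x, slMap X U L y⁆
    simp only [slMap_eq]
    generalize hG : fullGen X U L = G
    have hl := fullGen_lie h
    rw [hG] at hl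
    have hs : ∀ (p : Prop) [Decidable p] (c : ℂ) (r : R), c • (if p then r else 0)
        = if p then c • r else 0 := by
      intro p _ c r; split_ifs <;> simp
    have hv : ⁅x, y⁆.val = x.val * y.val - y.val * x.val := rfl
    simp only [hv, sum_lie, lie_sum, smul_lie, lie_smul, hl,
      Matrix.sub_apply, Matrix.mul_apply, sub_smul, Finset.sum_smul, smul_sub,
      Finset.sum_sub_distrib, hs]
    congr 1
    · simp only [Finset.sum_ite_eq', Finset.mem_univ, if_true, Finset.smul_sum, smul_smul]
      have h1 : ∀ m : Fin (n + 1), ∑ l, ∑ i, (y.val m l * x.val i m) • G i l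
          = ∑ i, ∑ l, (x.val i m * y.val m l) • G i l := by
        intro m
        rw [Finset.sum_comm]
        simp only [mul_comm]
      simp only [h1]
      conv_rhs => rw [Finset.sum_comm]
      refine Finset.sum_congr rfl fun i _ => ?_
      rw [Finset.sum_comm]
    · simp only [Finset.sum_ite_eq', Finset.sum_ite_eq, Finset.mem_univ, if_true, Finset.smul_sum,
        smul_smul, Finset.sum_ite_irrel, Finset.sum_const_zero]
      refine Finset.sum_congr rfl fun k _ => ?_
      rw [Finset.sum_comm]

theorem tensorU_scalar (v u : Fin n → R) (c : ℂ) (i : Fin n) :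
    tensorU v (fun i => -u i) (fun i j => if i = j then algebraMap ℂ R (c + 1) else 0) i
      = (∑ j, v j * u j) * u i + algebraMap ℂ R (n * c + c) * u i := by
  have hc : ∀ c : ℂ, u i * algebraMap ℂ R c = algebraMap ℂ R c * u i :=
    fun c => (Algebra.commutes c (u i)).symm
  simp only [tensorU, Finset.sum_mul, mul_ite, mul_zero, Finset.sum_ite_eq, Finset.mem_univ,
    if_true, neg_mul, mul_neg, Finset.sum_neg_distrib, neg_neg, Finset.sum_const,
    Finset.card_univ, Fintype.card_fin, nsmul_eq_mul, map_add, map_mul, map_natCast, map_one]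
  simp only [add_mul, mul_add, one_mul, mul_one, mul_assoc, hc]
  abel

end Generators

/-! ### Modules over `𝒟(n)` and tensor modules -/

/-- A `𝒟(n)`-module structure on the space `P`: the actions of the generators `t_i` and `∂_i`,
subject to the defining relations of `𝒟(n)`. -/
structure WeylModule (n : ℕ) (P : Type*) [AddCommGroup P] [Module ℂ P] where
  t : Fin n → Module.End ℂ P
  d : Fin n → Module.End ℂ P
  relations : WeylRelations t d

section TensorModules

variable {n : ℕ} {P : Type*} [AddCommGroup P] [Module ℂ P]

/-- The defining `𝒟(n)`-module `𝒪 = ℂ[t_1, …, t_n]`. -/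
def polynomialModule (n : ℕ) : WeylModule n (MvPolynomial (Fin n) ℂ) where
  t i := LinearMap.mulLeft ℂ (MvPolynomial.X i)
  d i := (MvPolynomial.pderiv i).toLinearMap
  relations := by
    refine ⟨fun i j => ?_, fun i j => ?_, fun i j => ?_⟩
    · refine LinearMap.ext fun f => ?_
      simp [Ring.lie_def, mul_left_comm]
    · have h : ⁅MvPolynomial.pderiv (R := ℂ) i, MvPolynomial.pderiv (R := ℂ) j⁆ = 0 := by
        refine MvPolynomial.derivation_ext fun k => ?_
        rw [Derivation.commutator_apply, MvPolynomial.pderiv_X, MvPolynomial.pderiv_X]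
        simp only [Pi.single_apply]
        split_ifs <;> simp
      have h2 := Derivation.commutator_coe_linear_map (D1 := MvPolynomial.pderiv (R := ℂ) i)
        (D2 := MvPolynomial.pderiv (R := ℂ) j)
      rw [h] at h2
      exact h2.symm
    · refine LinearMap.ext fun f => ?_
      simp only [Ring.lie_def, LinearMap.sub_apply, Module.End.mul_apply, LinearMap.mulLeft_apply,
        Derivation.coeFn_coe, Derivation.leibniz, MvPolynomial.pderiv_X, smul_eq_mul,
        Pi.single_apply]
      by_cases h : i = j
      · subst h; simp
      · simp [h, Ne.symm h]

/-- The twist of a `𝒟(n)`-module by the exponentiation automorphism `θ_b`, which sends `t_i` to `t_i`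
and `∂_i` to `∂_i + b_i`. It is the module `e^{b_1 t_1 + … + b_n t_n} Q`. -/
def WeylModule.exp (Q : WeylModule n P) (b : Fin n → ℂ) : WeylModule n P where
  t := Q.t
  d i := Q.d i + algebraMap ℂ (Module.End ℂ P) (b i)
  relations := by
    have hc : ∀ (c : ℂ) (x : Module.End ℂ P), ⁅algebraMap ℂ (Module.End ℂ P) c, x⁆ = 0 :=
      fun c x => sub_eq_zero.2 (Algebra.commutes c x)
    have hc' : ∀ (c : ℂ) (x : Module.End ℂ P), ⁅x, algebraMap ℂ (Module.End ℂ P) c⁆ = 0 :=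
      fun c x => sub_eq_zero.2 (Algebra.commutes c x).symm
    refine ⟨Q.relations.tt, fun i j => ?_, fun i j => ?_⟩
    · rw [add_lie, lie_add, lie_add, hc, hc, hc', Q.relations.dd]
      simp
    · rw [add_lie, hc, Q.relations.dt, add_zero]

/-- The twist of a `𝒟(n)`-module by the Fourier transform `ψ_S`, which sends `t_i` to `∂_i` and `∂_i`
to `-t_i` for `i ∈ S`, and fixes `t_i` and `∂_i` for `i ∉ S`. -/
def WeylModule.fourier (Q : WeylModule n P) (S : Finset (Fin n)) : WeylModule n P where
  t i := if i ∈ S then Q.d i else Q.t i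
  d i := if i ∈ S then -Q.t i else Q.d i
  relations := by
    have htd : ∀ i j, ⁅Q.t j, Q.d i⁆ = -if i = j then 1 else 0 := by
      intro i j; rw [← lie_skew, Q.relations.dt]
    refine ⟨fun i j => ?_, fun i j => ?_, fun i j => ?_⟩ <;>
    by_cases hi : i ∈ S <;> by_cases hj : j ∈ S <;>
    simp only [hi, hj, if_true, if_false, neg_lie, lie_neg, Q.relations.dd, Q.relations.tt,
      Q.relations.dt, htd, neg_zero, neg_neg, @eq_comm _ j i]
    all_goals
      rw [if_neg]
      all_goals first
        | rfl
        | exact neg_zero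
        | (rintro rfl; contradiction)

variable {V : Type*} [AddCommGroup V] [Module ℂ V]

/-- The `sl(n+1)`-module `T(P, V)` with underlying space `P ⊗ V`, for a `𝒟(n)`-module `P` and a
`gl(n)`-module `V`. -/
def tensorModule (Q : WeylModule n P) (σ : LieRep (Gl n) V) : LieRep (Sl n) (P ⊗[ℂ] V) :=
  slHom
    (tensorX (fun i => (Q.t i).rTensor V) (fun i => (Q.d i).rTensor V)
      (fun i j => (σ (Matrix.single i j 1)).lTensor P))
    (tensorU (fun i => (Q.t i).rTensor V) (fun i => (Q.d i).rTensor V)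
      (fun i j => (σ (Matrix.single i j 1)).lTensor P))
    (tensorL (fun i => (Q.t i).rTensor V))
    (tensor_slRelations
      (by
        have hr : ∀ f g : Module.End ℂ P, ⁅f.rTensor V, g.rTensor V⁆
            = (⁅f, g⁆ : Module.End ℂ P).rTensor V := by
          intro f g
          simp only [Ring.lie_def, LinearMap.rTensor_sub, LinearMap.rTensor_mul]
        refine ⟨fun i j => ?_, fun i j => ?_, fun i j => ?_⟩
        · rw [hr, Q.relations.tt, LinearMap.rTensor_zero]
        · rw [hr, Q.relations.dd, LinearMap.rTensor_zero]
        · rw [hr, Q.relations.dt]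
          split_ifs
          · exact LinearMap.rTensor_id V P
          · exact LinearMap.rTensor_zero V)
      (by
        have hl : ∀ f g : Module.End ℂ V, ⁅f.lTensor P, g.lTensor P⁆
            = (⁅f, g⁆ : Module.End ℂ V).lTensor P := by
          intro f g
          simp only [Ring.lie_def, LinearMap.lTensor_sub, LinearMap.lTensor_mul]
        refine ⟨fun i j k l => ?_⟩
        rw [hl, ← LieHom.map_lie]
        have : ⁅(Matrix.single i j 1 : Gl n), (Matrix.single k l 1 : Gl n)⁆
            = (if j = k then Matrix.single i l 1 else 0)
              - (if l = i then Matrix.single k j 1 else 0) := by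
          rw [Ring.lie_def]
          congr 1
          · split_ifs with h
            · subst h; simp
            · simp [h]
          · split_ifs with h
            · subst h; simp
            · simp [h]
        rw [this, map_sub, LinearMap.lTensor_sub]
        congr 1 <;> split_ifs <;> simp)
      (fun i j k => by
        rw [Ring.lie_def, sub_eq_zero]
        exact (LinearMap.rTensor_comp_lTensor _ _ _).trans (LinearMap.lTensor_comp_rTensor _ _ _).symm)
      (fun i j k => by
        rw [Ring.lie_def, sub_eq_zero]
        exact (LinearMap.rTensor_comp_lTensor _ _ _).trans (LinearMap.lTensor_comp_rTensor _ _ _).symm))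

/-- The exponential tensor module `T(b, V, S)`. Its space is `e^{bt} ℂ[t] ⊗ V`, where `f ⊗ v` stands
for `e^{bt} f ⊗ v` and `bt = b_1 t_1 + … + b_n t_n`, and `sl(n+1)` acts on it through
`ω_{V,S} = (ψ_S ⊗ 1) ω_V`. -/
def expTensorModule (b : Fin n → ℂ) (σ : LieRep (Gl n) V) (S : Finset (Fin n)) :
    LieRep (Sl n) (MvPolynomial (Fin n) ℂ ⊗[ℂ] V) :=
  tensorModule (((polynomialModule n).exp b).fourier S) σ

/-- The one-dimensional `gl(n)`-module `V_a`, on which a matrix `A` acts by `a * tr A`. -/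
def traceRep (n : ℕ) (a : ℂ) : LieRep (Gl n) ℂ where
  toFun A := algebraMap ℂ (Module.End ℂ ℂ) (a * A.trace)
  map_add' A B := by rw [Matrix.trace_add, mul_add, map_add]
  map_smul' c A := by
    rw [Matrix.trace_smul, smul_eq_mul, mul_left_comm, map_mul, RingHom.id_apply, Algebra.smul_def]
  map_lie' {A B} := by
    rw [Ring.lie_def, Ring.lie_def, Matrix.trace_sub, Matrix.trace_mul_comm A B, sub_self, mul_zero,
      map_zero, Algebra.commutes, sub_self]

end TensorModules

/-! ### The modules of Nilsson -/

section Nilsson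

open MvPolynomial

variable {n : ℕ}

/-- The automorphism of `ℂ[h_1, …, h_n]` that sends `h_i` to `h_i + c` and fixes the other
variables. In particular `σ_i` is `shift i (-1)`, and its inverse is `shift i 1`. -/
def shift (i : Fin n) (c : ℂ) : MvPolynomial (Fin n) ℂ →ₐ[ℂ] MvPolynomial (Fin n) ℂ :=
  aeval fun k => if k = i then X k + C c else X k

/-- The action of `h_i` (for `i = j`) and of `e_{ij}` (for `i ≠ j`) on `M_b^S`. -/
def nilssonX (S : Finset (Fin n)) (b : ℂ) (i j : Fin n) :
    Module.End ℂ (MvPolynomial (Fin n) ℂ) :=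
  if i = j then LinearMap.mulLeft ℂ (X i)
  else
    LinearMap.mulLeft ℂ
      (if i ∈ S then
        if j ∈ S then X j - C b else 1
      else
        if j ∈ S then (X i - C b - 1) * (X j - C b) else X i - C b - 1)
    * (shift i (-1)).toLinearMap * (shift j 1).toLinearMap

/-- The action of `e_{i,n+1}` on `M_b^S`. -/
def nilssonU (S : Finset (Fin n)) (b : ℂ) (i : Fin n) : Module.End ℂ (MvPolynomial (Fin n) ℂ) :=
  LinearMap.mulLeft ℂ
    (if i ∈ S then (∑ k, X k) + C b else ((∑ k, X k) + C b) * (X i - C b - 1))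
  * (shift i (-1)).toLinearMap

/-- The action of `e_{n+1,j}` on `M_b^S`. -/
def nilssonL (S : Finset (Fin n)) (b : ℂ) (j : Fin n) : Module.End ℂ (MvPolynomial (Fin n) ℂ) :=
  LinearMap.mulLeft ℂ (if j ∈ S then -(X j - C b) else -1) * (shift j 1).toLinearMap

theorem shift_comm (i j : Fin n) (c c' : ℂ) (f : MvPolynomial (Fin n) ℂ) :
    shift i c (shift j c' f) = shift j c' (shift i c f) := by
  have : (shift i c).comp (shift j c') = (shift j c').comp (shift i c) := by
    refine MvPolynomial.algHom_ext fun k => ?_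
    have hX : ∀ (i k : Fin n) (c : ℂ), shift i c (X k) = X k + if k = i then C c else 0 := by
      intro i k c
      simp only [shift, aeval_X]
      split_ifs <;> simp
    have hC : ∀ (i k j : Fin n) (c c' : ℂ), shift i c (if k = j then C c' else 0)
        = if k = j then C c' else 0 := by
      intro i k j c c'
      split_ifs
      · exact (shift i c).commutes c'
      · exact map_zero _
    simp only [AlgHom.comp_apply, hX, map_add, hC]
    exact add_right_comm _ _ _
  exact DFunLike.congr_fun this f

theorem shift_neg (i : Fin n) (c : ℂ) (f : MvPolynomial (Fin n) ℂ) :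
    shift i c (shift i (-c) f) = f := by
  have : (shift i c).comp (shift i (-c)) = AlgHom.id ℂ _ := by
    refine MvPolynomial.algHom_ext fun k => ?_
    by_cases h1 : k = i <;> simp [shift, h1, algebraMap_eq]
  exact DFunLike.congr_fun this f

theorem nilsson_slRelations (S : Finset (Fin n)) (b : ℂ) :
    SlRelations (nilssonX S b) (nilssonU S b) (nilssonL S b) := by
  have hX : ∀ (i k : Fin n) (c : ℂ), shift i c (X k) = if k = i then X k + C c else X k :=
    fun i k c => by simp only [shift, aeval_X]
  have hC : ∀ (i : Fin n) (c c' : ℂ), shift i c (C c') = C c' := fun i c c' => (shift i c).commutes c'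
  have sn : ∀ (i : Fin n) (f : MvPolynomial (Fin n) ℂ), shift i (-1) (shift i 1 f) = f := by
    intro i f
    simpa using shift_neg i (-1) f
  set p : Fin n → MvPolynomial (Fin n) ℂ := fun i => if i ∈ S then 1 else X i - C b - 1 with hp
  set q : Fin n → MvPolynomial (Fin n) ℂ := fun j => if j ∈ S then X j - C b else 1 with hq
  set u : Fin n → Module.End ℂ (MvPolynomial (Fin n) ℂ) :=
    fun i => LinearMap.mulLeft ℂ (p i) * (shift i (-1)).toLinearMap with hu
  set v : Fin n → Module.End ℂ (MvPolynomial (Fin n) ℂ) :=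
    fun j => LinearMap.mulLeft ℂ (q j) * (shift j 1).toLinearMap with hv
  have hpp : ∀ (i j : Fin n) (c : ℂ), i ≠ j → shift j c (p i) = p i := by
    intro i j c hij
    simp only [hp]
    split_ifs <;> simp [hX, hC, hij]
  have hqq : ∀ (i j : Fin n) (c : ℂ), i ≠ j → shift j c (q i) = q i := by
    intro i j c hij
    simp only [hq]
    split_ifs <;> simp [hX, hC, hij]
  have uapp : ∀ i f, u i f = p i * shift i (-1) f := fun i f => rfl
  have vapp : ∀ i f, v i f = q i * shift i 1 f := fun i f => rfl
  have uu : ∀ i j, ⁅u i, u j⁆ = 0 := by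
    intro i j
    by_cases h : i = j
    · subst h; exact lie_self _
    · refine LinearMap.ext fun f => ?_
      simp only [Ring.lie_def, LinearMap.sub_apply, Module.End.mul_apply, uapp, map_mul,
        hpp _ _ _ h, hpp _ _ _ (Ne.symm h), shift_comm i j, LinearMap.zero_apply]
      ring
  have vv : ∀ i j, ⁅v i, v j⁆ = 0 := by
    intro i j
    by_cases h : i = j
    · subst h; exact lie_self _
    · refine LinearMap.ext fun f => ?_
      simp only [Ring.lie_def, LinearMap.sub_apply, Module.End.mul_apply, vapp, map_mul,
        hqq _ _ _ h, hqq _ _ _ (Ne.symm h), shift_comm i j, LinearMap.zero_apply]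
      ring
  have vu : ∀ i, v i * u i = LinearMap.mulLeft ℂ (X i - C b) := by
    intro i
    refine LinearMap.ext fun f => ?_
    simp only [Module.End.mul_apply, uapp, vapp, map_mul, shift_neg, LinearMap.mulLeft_apply]
    rw [← mul_assoc]
    congr 1
    simp only [hp, hq]
    split_ifs
    · simp
    · simp [hX, hC]; ring
  have uv : ∀ i, u i * v i = LinearMap.mulLeft ℂ (X i - C b - 1) := by
    intro i
    refine LinearMap.ext fun f => ?_
    simp only [Module.End.mul_apply, uapp, vapp, map_mul, sn, LinearMap.mulLeft_apply]
    rw [← mul_assoc]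
    congr 1
    simp only [hp, hq]
    split_ifs
    · simp [hX, hC]; ring
    · simp
  have uv' : ∀ i j, i ≠ j → u i * v j = v j * u i := by
    intro i j h
    refine LinearMap.ext fun f => ?_
    simp only [Module.End.mul_apply, uapp, vapp, map_mul, hqq _ _ _ (Ne.symm h), hpp _ _ _ h,
      shift_comm i j]
    ring
  have hw : WeylRelations v (fun i => -u i) := by
    refine ⟨vv, fun i j => by rw [neg_lie, lie_neg, neg_neg, uu], fun i j => ?_⟩
    rw [neg_lie, Ring.lie_def]
    by_cases h : i = j
    · subst h
      rw [if_pos rfl, uv, vu]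
      refine LinearMap.ext fun f => ?_
      simp only [LinearMap.neg_apply, LinearMap.sub_apply, LinearMap.mulLeft_apply,
        Module.End.one_apply]
      ring
    · rw [if_neg h, uv' i j h, sub_self, neg_zero]
  set E : Fin n → Fin n → Module.End ℂ (MvPolynomial (Fin n) ℂ) :=
    fun i j => if i = j then algebraMap ℂ _ (b + 1) else 0 with hE
  have hEc : ∀ (i j : Fin n) (x : Module.End ℂ (MvPolynomial (Fin n) ℂ)), ⁅x, E i j⁆ = 0 := by
    intro i j x
    simp only [hE, Ring.lie_def]
    split_ifs
    · rw [Algebra.commutes, sub_self]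
    · simp
  have hg : GlRelations E := by
    refine ⟨fun i j k l => ?_⟩
    rw [hEc]
    simp only [hE]
    by_cases h1 : j = k
    · subst h1
      by_cases h2 : l = i
      · subst h2; simp
      · simp [h2, Ne.symm h2]
    · by_cases h2 : l = i
      · subst h2; simp [h1, Ne.symm h1]
      · simp [h1, h2]
  have key := tensor_slRelations hw hg (fun i j k => hEc j k (v i)) (fun i j k => hEc j k (-u i))
  have vn : ∀ (x : Module.End ℂ (MvPolynomial (Fin n) ℂ)) (i : Fin n), x * -u i = -(x * u i) :=
    fun x i => LinearMap.ext fun f => map_neg x (u i f)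
  have nv : ∀ (x : Module.End ℂ (MvPolynomial (Fin n) ℂ)) (i : Fin n), -u i * x = -(u i * x) :=
    fun x i => LinearMap.ext fun f => rfl
  have nn : ∀ (x y : Module.End ℂ (MvPolynomial (Fin n) ℂ)), -x * y = -(x * y) :=
    fun x y => LinearMap.ext fun f => rfl
  have e1 : nilssonX S b = tensorX v (fun i => -u i) E := by
    funext i j
    have h1 : tensorX v (fun i => -u i) E i j = E i j + v j * u i - if i = j then 1 else 0 := by
      simp only [tensorX, vn, sub_neg_eq_add]
    rw [h1]
    refine LinearMap.ext fun f => ?_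
    by_cases h : i = j
    · subst h
      simp only [nilssonX, if_true, hE, vu, LinearMap.mulLeft_apply, LinearMap.add_apply,
        LinearMap.sub_apply, Module.End.one_apply, Module.algebraMap_end_apply, smul_eq_C_mul,
        C_add, C_1]
      ring
    · simp only [nilssonX, if_neg h, hE, ← uv' i j h, Module.End.mul_apply, uapp, vapp,
        zero_add, sub_zero,
        map_mul, hqq _ _ _ (Ne.symm h), LinearMap.mulLeft_apply, AlgHom.toLinearMap_apply]
      simp only [hp, hq]
      split_ifs <;> ring
  have e2 : nilssonU S b = tensorU v (fun i => -u i) E := by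
    funext i
    have h1 : ∑ j, v j * u j = LinearMap.mulLeft ℂ ((∑ k, X k) - C (n * b)) := by
      simp only [vu]
      refine LinearMap.ext fun f => ?_
      simp [LinearMap.sum_apply, Finset.sum_mul, sub_mul]
      rw [mul_assoc]
    have h2 : tensorU v (fun i => -u i) E i
        = (∑ j, v j * u j) * u i + algebraMap ℂ _ (n * b + b) * u i := by
      exact tensorU_scalar v u b i
    rw [h2, h1]
    refine LinearMap.ext fun f => ?_
    simp only [nilssonU, LinearMap.add_apply, Module.End.mul_apply, uapp, LinearMap.mulLeft_apply,
      Module.algebraMap_end_apply, smul_eq_C_mul, map_add, AlgHom.toLinearMap_apply, hp]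
    split_ifs <;> ring
  have e3 : nilssonL S b = tensorL v := by
    funext j
    refine LinearMap.ext fun f => ?_
    simp only [nilssonL, tensorL, LinearMap.neg_apply, vapp, Module.End.mul_apply,
      LinearMap.mulLeft_apply, AlgHom.toLinearMap_apply, hq]
    split_ifs <;> ring
  rw [e1, e2, e3]
  exact key

/-- The `sl(n+1)`-module `M_b^S` of Nilsson with underlying space `ℂ[h_1, …, h_n]`. -/
def nilssonModule (S : Finset (Fin n)) (b : ℂ) : LieRep (Sl n) (MvPolynomial (Fin n) ℂ) :=
  slHom (nilssonX S b) (nilssonU S b) (nilssonL S b) (nilsson_slRelations S b)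

/-- The parameter `b_S ∈ (ℂ^*)^n` attached to `b ∈ (ℂ^*)^(n+1)` and a subset `S` of `{1, …, n}`:
`(b_S)_i = -b_i / b_{n+1}` for `i ∈ S` and `(b_S)_j = b_{n+1} / b_j` for `j ∉ S`. -/
def nilssonParameter (S : Finset (Fin n)) (b : Fin (n + 1) → ℂˣ) (i : Fin n) : ℂ :=
  if i ∈ S then -((b i.castSucc : ℂ) / (b (Fin.last n) : ℂ))
  else (b (Fin.last n) : ℂ) / (b i.castSucc : ℂ)

end Nilsson

end HFree

end

/-!
Write `h_{n+1} = -(h_1 + ⋯ + h_n)` and replace `e_{ij}` by its class `el i j` modulo the identity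
matrix, so that all indices `1, …, n+1` play the same role.

*First part.* The space `ℂ[h_1, …, h_n]` of `F_b M_a^S` is a module over the Weyl algebra, with `t_j`
acting as `-e_{n+1,j}` and `∂_i` as a multiple of `p_i σ_i` (`nilssonWeyl`). The action of `sl(n+1)`
is recovered from it by the formulas that define `T(-, V_{a+1})`. After an inverse Fourier transform
in the variables outside `S`, the polynomial `1` is a common eigenvector of the derivatives, with eigenvalues
`b_S`, and it generates the module. Since `ℂ[t_1, …, t_n]` is a simple module over the Weyl algebra,
a module with such a generator is `e^{b_S t} ℂ[t_1, …, t_n]` (`WeylModule.exists_equiv_exp`).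

*Second part.* As `U(𝔥)` is the polynomial algebra in the `h_k`, a module that is `𝔥`-free of rank `1`
may be taken to be `ℂ[h_1, …, h_n]` with `𝔥` acting by multiplication
(`IsHFreeOfRank.exists_polynomialRep`). Then `e_{ij}` acts by a translation `tr i j` followed by
multiplication by a polynomial `P_{ij} = e_{ij} · 1`, and the product `e_{ij} e_{ji}` acts by
multiplication by `R_{ij} = P_{ij} · tr i j (P_{ji})`. The argument has three steps.

* There is a constant `a` with `R_{ij} = (h_i - a - 1)(h_j - a)` for all `i ≠ j`
  (`ShiftRelations.exists_rootProduct`). Indeed `R_{ij}` solves the difference equation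
  `R_{ij} - R_{ji} = h_i - h_j`, and for `n ≥ 2` the commutation relations make the difference of
  `R_{ij}` and the particular solution `(h_i - 1) h_j` invariant under so many translations that only
  two constants are left. Computing `e_{ik} e_{ji} e_{ij} e_{ki}` in two ways expresses one
  of them by the other, `a`, which is the same for all `i ≠ j`.
  For `n = 1` there is one constant, and `a` is a root of a quadratic equation.
* The two factors of `R_{ij}` are prime, so `P_{ij}` is, up to a scalar, one of the four divisors of
  `R_{ij}`. For `n ≥ 2` the relation `e_{ik} e_{ji} = (h_i - a - 1) e_{jk}` shows that whether
  `h_i - a - 1` divides `P_{ij}` depends only on `i`, and that the scalars have the form `b_i / b_j`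
  (`ShiftRelations.exists_parameters`).
* If `h_{n+1} - a - 1` does not occur as a factor, these are the formulas of `F_b M_a^S`, where `S`
  consists of the indices `i ≤ n` for which `h_i - a - 1` does not occur either, and the first part
  applies. The twist by `τ` exchanges occurrence and non-occurrence, which reduces the other case to
  this one.
-/

noncomputable section

namespace HFree

open MvPolynomial

/-! ### Isomorphisms of modules -/

section Isomorphisms

variable {L : Type*} [LieRing L] [LieAlgebra ℂ L]
variable {M : Type*} [AddCommGroup M] [Module ℂ M] {N : Type*} [AddCommGroup N] [Module ℂ N]
variable {P : Type*} [AddCommGroup P] [Module ℂ P]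

theorem Isomorphic.symm {ρ : LieRep L M} {ρ' : LieRep L N} (h : Isomorphic ρ ρ') :
    Isomorphic ρ' ρ := by
  obtain ⟨e, he⟩ := h
  exact ⟨e.symm, fun x m => by rw [LinearEquiv.symm_apply_eq, he, LinearEquiv.apply_symm_apply]⟩

theorem Isomorphic.trans {ρ : LieRep L M} {ρ' : LieRep L N} {ρ'' : LieRep L P}
    (h : Isomorphic ρ ρ') (h' : Isomorphic ρ' ρ'') : Isomorphic ρ ρ'' := by
  obtain ⟨e, he⟩ := h
  obtain ⟨f, hf⟩ := h'
  exact ⟨e.trans f, fun x m => by simp [he, hf]⟩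

theorem Isomorphic.comp {ρ : LieRep L M} {ρ' : LieRep L N} (h : Isomorphic ρ ρ')
    (φ : L →ₗ⁅ℂ⁆ L) : Isomorphic (ρ.comp φ) (ρ'.comp φ) := by
  obtain ⟨e, he⟩ := h
  exact ⟨e, fun x m => he (φ x) m⟩

/-- Transport of a representation along a linear equivalence. -/
def conjRep (ρ : LieRep L M) (e : M ≃ₗ[ℂ] N) : LieRep L N :=
  LieHom.comp (e.lieConj : Module.End ℂ M →ₗ⁅ℂ⁆ Module.End ℂ N) ρ

theorem conjRep_apply (ρ : LieRep L M) (e : M ≃ₗ[ℂ] N) (x : L) (m : N) :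
    conjRep ρ e x m = e (ρ x (e.symm m)) := rfl

theorem isomorphic_conjRep (ρ : LieRep L M) (e : M ≃ₗ[ℂ] N) : Isomorphic ρ (conjRep ρ e) :=
  ⟨e, fun x m => by rw [conjRep_apply, e.symm_apply_apply]⟩

end Isomorphisms

theorem tau_tau {n : ℕ} (x : Sl n) : tau n (tau n x) = x := by
  apply Subtype.ext
  change -(-x.val.transpose).transpose = x.val
  rw [Matrix.transpose_neg, Matrix.transpose_transpose, neg_neg]

/-! ### Elementary matrices modulo the identity -/

section Elementary

variable {n : ℕ}

/-- The element `e_{ij} - (δ_{ij} / (n+1)) I` of `sl(n+1)`. For `i ≠ j` it is the elementary matrix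
`e_{ij}`, and for `i = j ≤ n` it is `h_i`. These elements span `sl(n+1)` and satisfy the commutation
relations of the elementary matrices of `gl(n+1)`, which makes all indices `1, …, n+1` alike. -/
def el (i j : Fin (n + 1)) : Sl n :=
  ⟨Matrix.single i j 1 - (if i = j then (1 / (n + 1) : ℂ) else 0) • 1, mem_sl (by
    have hn : (n + 1 : ℂ) ≠ 0 := Nat.cast_add_one_ne_zero n
    rw [Matrix.trace_sub, Matrix.trace_smul, Matrix.trace_one]
    by_cases h : i = j
    · subst h
      simp [hn]
    · simp [h])⟩

theorem el_lie (i j k l : Fin (n + 1)) :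
    ⁅(el i j : Sl n), el k l⁆ = (if j = k then el i l else 0) - (if l = i then el k j else 0) := by
  apply Subtype.ext
  have h1 : ⁅(el i j : Sl n), el k l⁆.val
      = Matrix.single i j 1 * Matrix.single k l 1 - Matrix.single k l 1 * Matrix.single i j 1 := by
    change (el i j).val * (el k l).val - (el k l).val * (el i j).val = _
    simp only [el, sub_mul, mul_sub, smul_mul_assoc, mul_smul_comm, one_mul, mul_one]
    module
  have h2 : ((if j = k then el i l else 0) - (if l = i then el k j else 0) : Sl n).val
      = (if j = k then (el i l : Sl n).val else 0) - (if l = i then (el k j : Sl n).val else 0) := by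
    split_ifs <;> rfl
  rw [h1, h2]
  by_cases hjk : j = k <;> by_cases hli : l = i
  · subst hjk; subst hli; simp [el]
  · subst hjk; simp [el, hli, Ne.symm hli]
  · subst hli; simp [el, hjk, Ne.symm hjk]
  · simp [hjk, hli]

theorem sum_el (x : Sl n) : x = ∑ i, ∑ j, x.val i j • (el i j : Sl n) := by
  apply Subtype.ext
  have ht : ∑ i, x.val i i = 0 := trace_eq_zero x
  have h1 : (∑ i, ∑ j, x.val i j • (el i j : Sl n)).val
      = ∑ i, ∑ j, x.val i j • (el i j : Sl n).val := by
    simp only [AddSubmonoidClass.coe_finset_sum]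
    rfl
  rw [h1]
  simp only [el, smul_sub, Finset.sum_sub_distrib, ite_smul, zero_smul, smul_ite, smul_zero,
    Finset.sum_ite_eq, Finset.mem_univ, if_true, smul_smul]
  rw [← Finset.sum_smul, ← Finset.sum_mul, ht, zero_mul, zero_smul, sub_zero]
  conv_lhs => rw [Matrix.matrix_eq_sum_single x.val]
  simp

/-- A representation is determined by the action of the elements `el i j`. -/
theorem rep_apply {M : Type*} [AddCommGroup M] [Module ℂ M] (ρ : LieRep (Sl n) M) (x : Sl n) :
    ρ x = ∑ i, ∑ j, x.val i j • ρ (el i j) := by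
  conv_lhs => rw [sum_el x]
  simp only [map_sum, map_smul]

theorem tau_el (i j : Fin (n + 1)) : tau n (el i j) = -el j i := by
  apply Subtype.ext
  change -(el i j).val.transpose = -(el j i).val
  by_cases h : i = j
  · subst h; simp [el, Matrix.transpose_sub, Matrix.transpose_single]
  · simp [el, Matrix.transpose_single, h, Ne.symm h]

theorem rep_ext {M : Type*} [AddCommGroup M] [Module ℂ M] {ρ ρ' : LieRep (Sl n) M}
    (h : ∀ i j, ρ (el i j) = ρ' (el i j)) : ρ = ρ' := by
  refine LieHom.ext fun x => ?_
  rw [rep_apply, rep_apply ρ']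
  simp only [h]

theorem fullGen_self_sum {R : Type*} [Ring R] (X : Fin n → Fin n → R) (U L : Fin n → R) :
    ∑ i, fullGen X U L i i = 0 := by
  simp [Fin.sum_univ_castSucc, fullGen]

theorem slHom_el {R : Type*} [Ring R] [Algebra ℂ R] {X : Fin n → Fin n → R} {U L : Fin n → R}
    (h : SlRelations X U L) (i j : Fin (n + 1)) : slHom X U L h (el i j) = fullGen X U L i j := by
  change slMap X U L (el i j) = _
  rw [slMap_eq]
  have h1 : ∀ k l, (el i j : Sl n).val k l • fullGen X U L k l
      = (if i = k ∧ j = l then fullGen X U L k l else 0)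
        - (if i = j then (1 / (n + 1) : ℂ) else 0) • (if k = l then fullGen X U L k l else 0) := by
    intro k l
    by_cases hkl : k = l
    · subst hkl
      simp only [el, Matrix.sub_apply, Matrix.single_apply, Matrix.smul_apply, Matrix.one_apply_eq,
        sub_smul, smul_eq_mul, mul_one, if_true]
      split_ifs <;> simp
    · simp only [el, Matrix.sub_apply, Matrix.single_apply, Matrix.smul_apply,
        Matrix.one_apply_ne hkl, smul_zero, sub_zero, hkl, if_false]
      split_ifs <;> simp
  simp only [h1, Finset.sum_sub_distrib, ← Finset.smul_sum, Finset.sum_ite_eq, Finset.mem_univ,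
    if_true, fullGen_self_sum, smul_zero, sub_zero]
  simp [ite_and]

theorem phi_el (b : Fin (n + 1) → ℂˣ) (i j : Fin (n + 1)) :
    phi b (el i j) = ((b i : ℂ) / (b j : ℂ)) • el i j := by
  apply Subtype.ext
  change (Matrix.of fun k l => (b k : ℂ) / (b l : ℂ) * (el i j).val k l)
    = ((b i : ℂ) / (b j : ℂ)) • (el i j).val
  ext k l
  have hb : ∀ k, (b k : ℂ) ≠ 0 := fun k => (b k).ne_zero
  simp only [Matrix.of_apply, Matrix.smul_apply, smul_eq_mul, el, Matrix.sub_apply,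
    Matrix.single_apply, Matrix.one_apply]
  by_cases hkl : k = l
  · subst hkl
    by_cases hij : i = j
    · subst hij; simp [hb]
    · have : ¬ (i = k ∧ j = k) := fun h => hij (h.1.trans h.2.symm)
      simp [hij, this]
  · by_cases h : i = k ∧ j = l
    · obtain ⟨rfl, rfl⟩ := h; simp [hkl]
    · simp [hkl, h]

end Elementary

/-! ### Commuting families and the enveloping algebra of the Cartan subalgebra -/

/-- Evaluation of polynomials at a family of commuting elements of a noncommutative algebra. -/
theorem exists_aeval_of_commute {ι R : Type*} [Ring R] [Algebra ℂ R] (T : ι → R)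
    (h : ∀ i j, T i * T j = T j * T i) :
    ∃ φ : MvPolynomial ι ℂ →ₐ[ℂ] R, ∀ i, φ (X i) = T i := by
  have hc : ∀ a ∈ Set.range T, ∀ b ∈ Set.range T, a * b = b * a := by
    rintro _ ⟨i, rfl⟩ _ ⟨j, rfl⟩
    exact h i j
  have := Algebra.isMulCommutative_adjoin ℂ hc
  open scoped IsMulCommutative in
  let ψ : MvPolynomial ι ℂ →ₐ[ℂ] Algebra.adjoin ℂ (Set.range T) :=
    aeval fun i => ⟨T i, Algebra.subset_adjoin ⟨i, rfl⟩⟩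
  exact ⟨(Algebra.adjoin ℂ (Set.range T)).val.comp ψ, fun i => by simp [ψ]⟩

variable {n : ℕ}

/-- The polynomials `h_1, …, h_n` and `h_{n+1} = -(h_1 + ⋯ + h_n)`, by which the elements `el i i`
act on a module that is `𝔥`-free of rank `1`. -/
def yv (i : Fin (n + 1)) : MvPolynomial (Fin n) ℂ :=
  Fin.lastCases (-∑ k, X k) (fun k => X k) i

theorem yv_castSucc (i : Fin n) : yv i.castSucc = X i := by simp [yv]

theorem yv_last : yv (Fin.last n) = -∑ k, X k := by simp [yv]

theorem el_self_mem_cartan (i : Fin (n + 1)) : (el i i : Sl n) ∈ cartan n := by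
  change (Matrix.single i i (1 : ℂ) -
    (if i = i then (1 / (n + 1) : ℂ) else 0) • (1 : Matrix (Fin (n + 1)) (Fin (n + 1)) ℂ)).IsDiag
  refine Matrix.IsDiag.sub ?_ (Matrix.IsDiag.smul _ Matrix.isDiag_one)
  intro k l hkl
  rw [Matrix.single_apply, if_neg]
  rintro ⟨rfl, rfl⟩
  exact hkl rfl

/-- The element `el i i` of the Cartan subalgebra. -/
def elCartan (i : Fin (n + 1)) : cartan n := ⟨el i i, el_self_mem_cartan i⟩

theorem cartan_lie (x y : cartan n) : ⁅x, y⁆ = 0 := by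
  apply Subtype.ext
  apply Subtype.ext
  change x.val.val * y.val.val - y.val.val * x.val.val = 0
  have hx : x.val.val.IsDiag := x.property
  have hy : y.val.val.IsDiag := y.property
  rw [← hx.diagonal_diag, ← hy.diagonal_diag, Matrix.diagonal_mul_diagonal,
    Matrix.diagonal_mul_diagonal]
  simp [mul_comm]

theorem sum_el_self : ∑ i, (el i i : Sl n) = 0 := by
  have hn : (n + 1 : ℂ) ≠ 0 := Nat.cast_add_one_ne_zero n
  apply Subtype.ext
  rw [AddSubmonoidClass.coe_finset_sum]
  simp only [el, if_true, Finset.sum_sub_distrib, Matrix.sum_single_one, Finset.sum_const,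
    Finset.card_univ, Fintype.card_fin]
  rw [← Nat.cast_smul_eq_nsmul ℂ, smul_smul]
  simp [hn]

theorem el_last_last :
    (el (Fin.last n) (Fin.last n) : Sl n) = -∑ i : Fin n, el i.castSucc i.castSucc := by
  have h := sum_el_self (n := n)
  rw [Fin.sum_univ_castSucc] at h
  exact eq_neg_of_add_eq_zero_right h

theorem sum_elCartan (x : cartan n) :
    x = ∑ i : Fin n, (x.val.val i.castSucc i.castSucc - x.val.val (Fin.last n) (Fin.last n)) •
      (elCartan i.castSucc : cartan n) := by
  have hx : ∀ i j, i ≠ j → x.val.val i j = 0 := fun i j h => x.property h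
  apply Subtype.ext
  rw [AddSubmonoidClass.coe_finset_sum]
  change x.val = ∑ i : Fin n,
    (x.val.val i.castSucc i.castSucc - x.val.val (Fin.last n) (Fin.last n)) • el i.castSucc i.castSucc
  conv_lhs => rw [sum_el x.val]
  have h1 : ∀ i, ∑ j, x.val.val i j • (el i j : Sl n) = x.val.val i i • el i i := by
    intro i
    rw [Finset.sum_eq_single i]
    · intro j _ hj
      rw [hx i j (Ne.symm hj), zero_smul]
    · simp
  simp only [h1, Fin.sum_univ_castSucc, sub_smul, Finset.sum_sub_distrib, ← Finset.smul_sum]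
  rw [el_last_last, smul_neg, sub_eq_add_neg]

/-- The enveloping algebra of the Cartan subalgebra is the polynomial algebra `ℂ[h_1, …, h_n]`. -/
theorem exists_envelopingAlgEquiv (n : ℕ) :
    ∃ φ : MvPolynomial (Fin n) ℂ ≃ₐ[ℂ] UniversalEnvelopingAlgebra ℂ (cartan n),
      ∀ i, φ (X i) = UniversalEnvelopingAlgebra.ι ℂ (elCartan i.castSucc) := by
  obtain ⟨φ, hφ⟩ := exists_aeval_of_commute
    (fun i : Fin n => UniversalEnvelopingAlgebra.ι ℂ (elCartan i.castSucc)) (fun i j => by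
      rw [← sub_eq_zero, ← Ring.lie_def, ← LieHom.map_lie, cartan_lie, map_zero])
  let c (i : Fin n) (x : cartan n) : ℂ :=
    x.val.val i.castSucc i.castSucc - x.val.val (Fin.last n) (Fin.last n)
  have cadd : ∀ i x y, c i (x + y) = c i x + c i y := fun i x y => add_sub_add_comm _ _ _ _
  have csmul : ∀ i (r : ℂ) x, c i (r • x) = r * c i x := fun i r x => (mul_sub _ _ _).symm
  let f : cartan n →ₗ⁅ℂ⁆ MvPolynomial (Fin n) ℂ :=
    { toFun := fun x => ∑ i, c i x • X i
      map_add' := fun x y => by simp only [cadd, add_smul, Finset.sum_add_distrib]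
      map_smul' := fun r x => by
        simp only [csmul, mul_smul, Finset.smul_sum, RingHom.id_apply]
      map_lie' := fun {x y} => by
        rw [cartan_lie, Ring.lie_def, mul_comm, sub_self]
        have : ∀ i, c i 0 = 0 := fun i => sub_self _
        simp [this] }
  have hf : ∀ i : Fin n, f (elCartan i.castSucc) = X i := by
    intro i
    change ∑ j, c j (elCartan i.castSucc) • X j = X i
    have : ∀ j, c j (elCartan i.castSucc) = if j = i then 1 else 0 := by
      intro j
      change (el i.castSucc i.castSucc : Sl n).val j.castSucc j.castSucc
        - (el i.castSucc i.castSucc : Sl n).val (Fin.last n) (Fin.last n) = _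
      have h1 : ¬ (i.castSucc = Fin.last n) := (Fin.castSucc_lt_last i).ne
      by_cases h : j = i
      · subst h; simp [el, Matrix.single_apply, h1]
      · simp [el, Matrix.single_apply, h1, h, Ne.symm h]
    simp [this]
  let ψ := UniversalEnvelopingAlgebra.lift ℂ f
  refine ⟨AlgEquiv.ofAlgHom φ ψ ?_ ?_, hφ⟩
  · refine UniversalEnvelopingAlgebra.hom_ext ℂ (LieHom.ext fun x => ?_)
    change φ (ψ (UniversalEnvelopingAlgebra.ι ℂ x)) = UniversalEnvelopingAlgebra.ι ℂ x
    rw [UniversalEnvelopingAlgebra.lift_ι_apply]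
    conv_rhs => rw [sum_elCartan x]
    change φ (∑ i, c i x • X i) = _
    rw [map_sum, map_sum]
    refine Finset.sum_congr rfl fun i _ => ?_
    rw [map_smul, hφ, map_smul]
  · refine MvPolynomial.algHom_ext fun i => ?_
    rw [AlgHom.comp_apply, hφ, UniversalEnvelopingAlgebra.lift_ι_apply, hf, AlgHom.id_apply]

/-- The action of the Cartan subalgebra on `ℂ[h_1, …, h_n]` is by multiplication. -/
def IsPolynomialRep (ρ : LieRep (Sl n) (MvPolynomial (Fin n) ℂ)) : Prop :=
  ∀ i f, ρ (el i i) f = yv i * f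

/-- Up to isomorphism, a module that is `𝔥`-free of rank `1` has the space `ℂ[h_1, …, h_n]`, with the
Cartan subalgebra acting by multiplication. -/
theorem IsHFreeOfRank.exists_polynomialRep {M : Type*} [AddCommGroup M] [Module ℂ M]
    {ρ : LieRep (Sl n) M} (h : IsHFreeOfRank 1 ρ) :
    ∃ ρ' : LieRep (Sl n) (MvPolynomial (Fin n) ℂ), IsPolynomialRep ρ' ∧ Isomorphic ρ ρ' := by
  let F := UniversalEnvelopingAlgebra.lift ℂ (ρ.comp (cartan n).incl)
  have hF : ∀ x : cartan n, F (UniversalEnvelopingAlgebra.ι ℂ x) = ρ x :=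
    fun x => UniversalEnvelopingAlgebra.lift_ι_apply ℂ _ x
  have hv : ∃ v : M, Function.Bijective fun u : UniversalEnvelopingAlgebra ℂ (cartan n) => F u v := by
    letI : Module (UniversalEnvelopingAlgebra ℂ (cartan n)) M := Module.compHom M F.toRingHom
    obtain ⟨b⟩ := h
    let e := (LinearEquiv.funUnique (Fin 1) (UniversalEnvelopingAlgebra ℂ (cartan n))
      (UniversalEnvelopingAlgebra ℂ (cartan n))).symm.trans b.equivFun.symm
    refine ⟨b 0, ?_⟩
    have he : (fun u : UniversalEnvelopingAlgebra ℂ (cartan n) => F u (b 0)) = e := by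
      funext u
      change u • b 0 = b.equivFun.symm (fun _ => u)
      rw [Module.Basis.equivFun_symm_apply, Fin.sum_univ_one]
    rw [he]
    exact e.bijective
  obtain ⟨v, hv⟩ := hv
  obtain ⟨φ, hφ⟩ := exists_envelopingAlgEquiv n
  let g : MvPolynomial (Fin n) ℂ →ₗ[ℂ] M :=
    (LinearMap.applyₗ v).comp (F.comp (φ : MvPolynomial (Fin n) ℂ →ₐ[ℂ] _)).toLinearMap
  have hg : ∀ f, g f = F (φ f) v := fun f => rfl
  let e := LinearEquiv.ofBijective g (hv.comp φ.bijective)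
  have he : ∀ f, e f = F (φ f) v := fun f => rfl
  have heX : ∀ (i : Fin n) f, e (X i * f) = ρ (el i.castSucc i.castSucc) (e f) := by
    intro i f
    rw [he, map_mul, map_mul, hφ, hF, he]
    rfl
  refine ⟨conjRep ρ e.symm, fun i f => ?_, isomorphic_conjRep ρ e.symm⟩
  rw [conjRep_apply, LinearEquiv.symm_symm, LinearEquiv.symm_apply_eq]
  refine Fin.lastCases ?_ (fun i => ?_) i
  · rw [el_last_last, yv_last, neg_mul, map_neg, Finset.sum_mul, map_sum, map_neg, map_sum]
    simp only [heX, LinearMap.neg_apply, LinearMap.sum_apply]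
  · rw [yv_castSucc, heX]

/-! ### Translations of `ℂ[h_1, …, h_n]` along the root lattice -/

/-- The automorphism of `ℂ[h_1, …, h_n]` with `h_i ↦ h_i - 1` and `h_j ↦ h_j + 1`, where `h_{n+1}`
stands for `-(h_1 + ⋯ + h_n)`; it is the identity if `i = j`. -/
def tr (i j : Fin (n + 1)) : MvPolynomial (Fin n) ℂ →ₐ[ℂ] MvPolynomial (Fin n) ℂ :=
  aeval fun k => X k - C (if k.castSucc = i then 1 else 0) + C (if k.castSucc = j then 1 else 0)

theorem tr_C (i j : Fin (n + 1)) (c : ℂ) : tr i j (C c) = C c := (tr i j).commutes c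

theorem tr_yv (i j k : Fin (n + 1)) :
    tr i j (yv k) = yv k - C (if k = i then 1 else 0) + C (if k = j then 1 else 0) := by
  have hs : ∀ i : Fin (n + 1), ∑ k : Fin n, (if k.castSucc = i then (1 : ℂ) else 0)
      = 1 - if Fin.last n = i then 1 else 0 := by
    intro i
    have h : ∑ k : Fin (n + 1), (if k = i then (1 : ℂ) else 0) = 1 := by simp
    rw [Fin.sum_univ_castSucc] at h
    exact eq_sub_of_add_eq h
  refine Fin.lastCases ?_ (fun k => ?_) k
  · simp only [yv_last, tr, map_neg, map_sum, aeval_X, Finset.sum_add_distrib,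
      Finset.sum_sub_distrib]
    rw [← map_sum, ← map_sum, hs, hs, map_sub, map_sub]
    ring
  · rw [yv_castSucc, tr, aeval_X]

theorem tr_tr (i j k : Fin (n + 1)) (f : MvPolynomial (Fin n) ℂ) :
    tr i j (tr j k f) = tr i k f := by
  have : (tr i j).comp (tr j k) = tr i k := by
    refine MvPolynomial.algHom_ext fun l => ?_
    simp only [AlgHom.comp_apply, ← yv_castSucc, tr_yv, map_add, map_sub, tr_C]
    ring
  exact DFunLike.congr_fun this f

theorem tr_self (i : Fin (n + 1)) (f : MvPolynomial (Fin n) ℂ) : tr i i f = f := by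
  have : tr i i = AlgHom.id ℂ _ := by
    refine MvPolynomial.algHom_ext fun l => ?_
    simp only [AlgHom.id_apply, ← yv_castSucc, tr_yv]
    ring
  exact DFunLike.congr_fun this f

theorem tr_comm (i j k l : Fin (n + 1)) (f : MvPolynomial (Fin n) ℂ) :
    tr i j (tr k l f) = tr k l (tr i j f) := by
  have : (tr i j).comp (tr k l) = (tr k l).comp (tr i j) := by
    refine MvPolynomial.algHom_ext fun l => ?_
    simp only [AlgHom.comp_apply, ← yv_castSucc, tr_yv, map_add, map_sub, tr_C]
    ring
  exact DFunLike.congr_fun this f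

theorem tr_injective (i j : Fin (n + 1)) : Function.Injective (tr (n := n) i j) := by
  intro f g h
  have := congrArg (tr j i) h
  simpa only [tr_tr, tr_self] using this

/-- The polynomials `yv i` take any prescribed values of sum zero. -/
theorem eval_yv {q : Fin (n + 1) → ℂ} (hq : ∑ i, q i = 0) (i : Fin (n + 1)) :
    eval (fun k : Fin n => q k.castSucc) (yv i) = q i := by
  refine Fin.lastCases ?_ (fun i => ?_) i
  · rw [Fin.sum_univ_castSucc] at hq
    rw [yv_last, map_neg, map_sum]
    simp only [eval_X]
    exact neg_eq_of_add_eq_zero_right hq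
  · rw [yv_castSucc, eval_X]

theorem exists_eval_yv_pair {i j : Fin (n + 1)} (hij : i ≠ j) (x : ℂ) :
    ∃ p : Fin n → ℂ, eval p (yv i) = x ∧ eval p (yv j) = -x := by
  refine ⟨fun k => (Pi.single i x - Pi.single j x : Fin (n + 1) → ℂ) k.castSucc, ?_, ?_⟩ <;>
  · rw [eval_yv (by simp)]
    simp [hij, Ne.symm hij]

theorem exists_eval_yv_triple {i j k : Fin (n + 1)} (hij : i ≠ j) (hik : i ≠ k) (hjk : j ≠ k)
    (x y : ℂ) :
    ∃ p : Fin n → ℂ, eval p (yv i) = x ∧ eval p (yv j) = y ∧ eval p (yv k) = -(x + y) := by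
  refine ⟨fun l => (Pi.single i x + Pi.single j y - Pi.single k (x + y) : Fin (n + 1) → ℂ)
    l.castSucc, ?_, ?_, ?_⟩ <;>
  · rw [eval_yv (by simp [Finset.sum_add_distrib])]
    simp [hij, Ne.symm hij, hik, hjk, Ne.symm hik, Ne.symm hjk]

theorem yv_ne {i j : Fin (n + 1)} (hij : i ≠ j) : (yv i : MvPolynomial (Fin n) ℂ) ≠ yv j := by
  intro h
  obtain ⟨p, hi, hj⟩ := exists_eval_yv_pair hij 1
  rw [h, hj] at hi
  norm_num at hi

/-- A polynomial that is invariant under all translations by roots is constant. -/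
theorem exists_eq_C_of_tr_eq {f : MvPolynomial (Fin n) ℂ} (h : ∀ i j, tr i j f = f) :
    ∃ c, f = C c := by
  refine ⟨eval 0 f, ?_⟩
  let T : AddSubmonoid (Fin n → ℂ) :=
    { carrier := {v | ∀ p, eval (p + v) f = eval p f}
      zero_mem' := fun p => by rw [add_zero]
      add_mem' := fun {v w} hv hw p => by rw [← add_assoc, hw, hv] }
  have h1 : ∀ i, (Pi.single i 1 : Fin n → ℂ) ∈ T := by
    intro i p
    have h2 : (eval (p + Pi.single i 1)).comp (tr i.castSucc (Fin.last n)).toRingHom = eval p := by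
      refine MvPolynomial.ringHom_ext (fun c => ?_) fun k => ?_
      · simp [tr_C]
      · have hk : k.castSucc ≠ Fin.last n := (Fin.castSucc_lt_last k).ne
        by_cases hki : k = i
        · subst hki; simp [tr, hk]
        · simp [tr, hk, hki]
    rw [← h2, RingHom.comp_apply]
    exact congrArg _ (h _ _).symm
  refine MvPolynomial.funext_set (fun _ => Set.range fun m : ℕ => (m : ℂ))
    (fun _ => Set.infinite_range_of_injective Nat.cast_injective) fun x hx => ?_
  choose m hm using fun i => hx i trivial
  have hxT : x ∈ T := by
    have : x = ∑ i, m i • (Pi.single i 1 : Fin n → ℂ) := by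
      funext k
      rw [Finset.sum_apply, Finset.sum_eq_single k]
      · simpa using (hm k).symm
      · intro b _ hb; simp [Ne.symm hb]
      · simp
    rw [this]
    exact T.sum_mem fun i _ => T.nsmul_mem (h1 i) _
  have := hxT 0
  rw [zero_add] at this
  rw [this, eval_C]

/-! ### The action of root vectors on the generator -/

/-- The relations satisfied by the polynomials `P i j = e_{ij} · 1` when `sl(n+1)` acts on
`ℂ[h_1, …, h_n]`, with the Cartan subalgebra acting by multiplication. -/
structure ShiftRelations (P : Fin (n + 1) → Fin (n + 1) → MvPolynomial (Fin n) ℂ) : Prop where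
  self : ∀ i, P i i = yv i
  lie : ∀ i j k l, P i j * tr i j (P k l) - P k l * tr k l (P i j)
    = (if j = k then P i l else 0) - (if l = i then P k j else 0)

/-- Since `e_{ij} h_k = (h_k - δ_{ki} + δ_{kj}) e_{ij}`, the root vector `e_{ij}` acts by a
translation followed by multiplication by `e_{ij} · 1`. -/
theorem IsPolynomialRep.apply_el {ρ : LieRep (Sl n) (MvPolynomial (Fin n) ℂ)}
    (hρ : IsPolynomialRep ρ) (i j : Fin (n + 1)) (f : MvPolynomial (Fin n) ℂ) :
    ρ (el i j) f = ρ (el i j) 1 * tr i j f := by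
  have key : ∀ k f, ρ (el i j) (yv k * f) = tr i j (yv k) * ρ (el i j) f := by
    intro k f
    have h1 := LieHom.map_lie ρ (el k k) (el i j)
    rw [el_lie, Ring.lie_def] at h1
    have h2 := LinearMap.congr_fun h1 f
    simp only [LinearMap.sub_apply, Module.End.mul_apply, hρ k] at h2
    rw [tr_yv]
    have h3 : ρ ((if k = i then el k j else 0) - if j = k then el i k else 0) f
        = (C (if k = i then 1 else 0) - C (if k = j then 1 else 0)) * ρ (el i j) f := by
      by_cases h1 : k = i
      · subst h1
        by_cases h2 : j = k
        · subst h2; simp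
        · simp [h2, Ne.symm h2]
      · by_cases h2 : j = k
        · subst h2; simp [h1]
        · simp [h1, h2, Ne.symm h2]
    rw [h3] at h2
    linear_combination h2
  induction f using MvPolynomial.induction_on with
  | C a =>
    have : (C a : MvPolynomial (Fin n) ℂ) = a • 1 := by rw [smul_eq_C_mul, mul_one]
    rw [tr_C, this, map_smul, mul_comm, smul_mul_assoc, one_mul]
  | add p q hp hq => rw [map_add, hp, hq, map_add, mul_add]
  | mul_X p k hp =>
    rw [mul_comm p, ← yv_castSucc, key, hp, map_mul]
    ring

theorem IsPolynomialRep.shiftRelations {ρ : LieRep (Sl n) (MvPolynomial (Fin n) ℂ)}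
    (hρ : IsPolynomialRep ρ) : ShiftRelations fun i j => ρ (el i j) 1 := by
  refine ⟨fun i => by rw [hρ, mul_one], fun i j k l => ?_⟩
  have h1 := LieHom.map_lie ρ (el i j) (el k l)
  rw [el_lie, Ring.lie_def] at h1
  have h2 := LinearMap.congr_fun h1 1
  simp only [LinearMap.sub_apply, Module.End.mul_apply] at h2
  rw [hρ.apply_el i j (ρ (el k l) 1), hρ.apply_el k l (ρ (el i j) 1)] at h2
  rw [← h2, map_sub, LinearMap.sub_apply]
  congr 1 <;> split_ifs <;> simp

section Relations

variable {P : Fin (n + 1) → Fin (n + 1) → MvPolynomial (Fin n) ℂ}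

/-- The polynomial by which `e_{ij} e_{ji}` acts. -/
def rootProduct (P : Fin (n + 1) → Fin (n + 1) → MvPolynomial (Fin n) ℂ) (i j : Fin (n + 1)) :
    MvPolynomial (Fin n) ℂ := P i j * tr i j (P j i)

theorem tr_rootProduct (i j : Fin (n + 1)) :
    tr j i (rootProduct P i j) = rootProduct P j i := by
  simp only [rootProduct, map_mul, tr_tr, tr_self]
  ring

variable (h : ShiftRelations P) {i j k : Fin (n + 1)}

include h
theorem ShiftRelations.rootProduct_sub (hij : i ≠ j) :
    rootProduct P i j - rootProduct P j i = yv i - yv j := by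
  have := h.lie i j j i
  simpa [rootProduct, h.self] using this

theorem ShiftRelations.ne_zero (hij : i ≠ j) : P i j ≠ 0 := by
  intro h0
  have := h.rootProduct_sub hij
  simp only [rootProduct, h0, map_zero, zero_mul, mul_zero, sub_zero] at this
  exact yv_ne hij (sub_eq_zero.1 this.symm)

/-- `e_{ij} e_{ji}` commutes with `e_{kl}` when the two pairs of indices are disjoint. -/
theorem ShiftRelations.tr_rootProduct_of_disjoint {l : Fin (n + 1)} (hik : i ≠ k) (hil : i ≠ l)
    (hjk : j ≠ k) (hjl : j ≠ l) (hkl : k ≠ l) :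
    tr k l (rootProduct P i j) = rootProduct P i j := by
  have h1 := h.lie i j k l
  have h2 := congrArg (tr i j) (h.lie j i k l)
  simp only [hjk, Ne.symm hil, hik, Ne.symm hjl, if_false, map_sub, map_mul, map_zero, tr_tr,
    tr_self] at h1 h2
  rw [tr_comm i j k l] at h2
  refine mul_left_cancel₀ (h.ne_zero hkl) ?_
  simp only [rootProduct, map_mul]
  linear_combination -(tr k l (tr i j (P j i))) * h1 - (P i j) * h2

/-- The identity `e_{ik} e_{ji} = [e_{ij} e_{ji}, e_{jk}]`. -/
theorem ShiftRelations.mul_tr_eq (hij : i ≠ j) (hik : i ≠ k) (hjk : j ≠ k) :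
    P i k * tr i k (P j i) = (rootProduct P i j - tr j k (rootProduct P i j)) * P j k := by
  have h1 := h.lie i j j k
  have h2 := congrArg (tr i j) (h.lie j i j k)
  simp only [hij, Ne.symm hik, Ne.symm hjk, if_false, if_true, map_sub, map_mul, map_zero, tr_tr,
    tr_self] at h1 h2
  simp only [rootProduct, map_mul, tr_tr]
  rw [tr_comm j k i j, tr_tr]
  linear_combination -(tr i k (P j i)) * h1 - (P i j) * h2

/-- The identity `e_{ij} e_{ki} = -[e_{ij} e_{ji}, e_{kj}]`. -/
theorem ShiftRelations.mul_tr_eq' (hij : i ≠ j) (hik : i ≠ k) (hjk : j ≠ k) :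
    P i j * tr i j (P k i) = (tr k j (rootProduct P i j) - rootProduct P i j) * P k j := by
  have h1 := h.lie i j k j
  have h2 := congrArg (tr i j) (h.lie j i k j)
  simp only [hik, Ne.symm hij, hjk, if_false, if_true, map_sub, map_mul, map_zero, tr_tr,
    tr_self] at h1 h2
  simp only [rootProduct, map_mul, tr_tr]
  rw [tr_comm k j i j]
  linear_combination (tr i j (tr k j (P j i))) * h1 + (P i j) * h2

/-- Comparison of the two expressions for `e_{ik} e_{ji}`. -/
theorem ShiftRelations.rootProduct_sub_tr (hij : i ≠ j) (hik : i ≠ k) (hjk : j ≠ k) :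
    rootProduct P i j - tr j k (rootProduct P i j)
      = tr j k (rootProduct P i k) - rootProduct P i k :=
  mul_right_cancel₀ (h.ne_zero hjk)
    ((h.mul_tr_eq hij hik hjk).symm.trans (h.mul_tr_eq' hik hij (Ne.symm hjk)))

/-- Both sides are the polynomial by which `e_{ik} e_{ji} e_{ij} e_{ki}` acts. -/
theorem ShiftRelations.tr_rootProduct_mul (hij : i ≠ j) (hik : i ≠ k) (hjk : j ≠ k) :
    tr j k (rootProduct P i j) * rootProduct P i k
      = (rootProduct P i j - tr j k (rootProduct P i j)) ^ 2 * rootProduct P j k := by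
  have h1 := h.mul_tr_eq hij hik hjk
  have h2 := congrArg (tr j k) (h.mul_tr_eq' hij hik hjk)
  simp only [map_mul, map_sub, tr_tr, tr_self] at h2
  rw [tr_comm j k i j, tr_tr] at h2
  have h3 : tr j k (rootProduct P i j) = tr i k (P j i) * tr j k (P i j) := by
    simp only [rootProduct, map_mul]
    rw [tr_comm j k i j, tr_tr, mul_comm]
  have h4 : rootProduct P i k = P i k * tr i k (P k i) := rfl
  have h5 : rootProduct P j k = P j k * tr j k (P k j) := rfl
  calc tr j k (rootProduct P i j) * rootProduct P i k
      = (P i k * tr i k (P j i)) * (tr j k (P i j) * tr i k (P k i)) := by rw [h3, h4]; ring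
    _ = _ := by rw [h1, h2, h5]; ring

end Relations

/-! ### The product of two opposite root vectors -/

theorem tr_yv_left {i j : Fin (n + 1)} (h : i ≠ j) : tr i j (yv i) = yv i - 1 := by
  rw [tr_yv, if_pos rfl, if_neg h, C_0, C_1, add_zero]

theorem tr_yv_right {i j : Fin (n + 1)} (h : i ≠ j) : tr i j (yv j) = yv j + 1 := by
  rw [tr_yv, if_pos rfl, if_neg (Ne.symm h), C_0, C_1, sub_zero]

theorem tr_yv_of_ne {i j k : Fin (n + 1)} (hi : k ≠ i) (hj : k ≠ j) : tr i j (yv k) = yv k := by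
  rw [tr_yv, if_neg hi, if_neg hj, C_0, sub_zero, add_zero]

theorem tr_symm_eq {i j : Fin (n + 1)} {f : MvPolynomial (Fin n) ℂ} (h : tr i j f = f) :
    tr j i f = f := by
  conv_lhs => rw [← h]
  rw [tr_tr, tr_self]

theorem tr_trans_eq {i j k : Fin (n + 1)} {f : MvPolynomial (Fin n) ℂ} (h : tr i j f = f)
    (h' : tr j k f = f) : tr i k f = f := by
  rw [← tr_tr i j k, h', h]

/-- The roots `ε_i - ε_l` with `i` fixed generate the root lattice. -/
theorem exists_eq_C_of_forall_tr_eq {f : MvPolynomial (Fin n) ℂ} (i : Fin (n + 1))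
    (h : ∀ l, tr i l f = f) : ∃ c, f = C c :=
  exists_eq_C_of_tr_eq fun k l => tr_trans_eq (tr_symm_eq (h k)) (h l)

theorem exists_ne_ne (hn : 2 ≤ n) (i j : Fin (n + 1)) : ∃ k, i ≠ k ∧ j ≠ k := by
  obtain ⟨k, -, hk⟩ := Finset.exists_mem_notMem_of_card_lt_card
    (s := ({i, j} : Finset (Fin (n + 1)))) (t := Finset.univ)
    (lt_of_le_of_lt Finset.card_le_two (by simpa using by omega))
  simp only [Finset.mem_insert, Finset.mem_singleton, not_or] at hk
  exact ⟨k, Ne.symm hk.1, Ne.symm hk.2⟩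

section Relations

variable {P : Fin (n + 1) → Fin (n + 1) → MvPolynomial (Fin n) ℂ} (h : ShiftRelations P)
  {i j k : Fin (n + 1)}

include h

/-- The difference equation `R_{ij} - R_{ji} = h_i - h_j` has the particular solution
`(h_i - 1) h_j`. -/
theorem ShiftRelations.tr_rootProduct_sub (hij : i ≠ j) :
    tr i j (rootProduct P i j - (yv i - 1) * yv j) = rootProduct P i j - (yv i - 1) * yv j := by
  apply tr_symm_eq
  have h1 := h.rootProduct_sub hij
  rw [map_sub, tr_rootProduct, map_mul, map_sub, map_one, tr_yv_right (Ne.symm hij),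
    tr_yv_left (Ne.symm hij)]
  linear_combination -h1

theorem ShiftRelations.tr_rootProduct_sub_of_disjoint {l : Fin (n + 1)} (hik : i ≠ k) (hil : i ≠ l)
    (hjk : j ≠ k) (hjl : j ≠ l) (hkl : k ≠ l) :
    tr k l (rootProduct P i j - (yv i - 1) * yv j) = rootProduct P i j - (yv i - 1) * yv j := by
  rw [map_sub, h.tr_rootProduct_of_disjoint hik hil hjk hjl hkl, map_mul, map_sub, map_one,
    tr_yv_of_ne hik hil, tr_yv_of_ne hjk hjl]

/-- In rank at least two, the solution of the difference equation is determined up to two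
constants, since it is invariant under many translations. -/
theorem ShiftRelations.exists_rootProduct_eq (hij : i ≠ j) (hik : i ≠ k) (hjk : j ≠ k) :
    ∃ a κ : ℂ, rootProduct P i j = (yv i - 1) * yv j - C a * (yv i + yv j) + C κ := by
  set c := rootProduct P i j - (yv i - 1) * yv j with hc
  set c' := rootProduct P i k - (yv i - 1) * yv k with hc'
  have cij : tr i j c = c := h.tr_rootProduct_sub hij
  have cik : tr i k c' = c' := h.tr_rootProduct_sub hik
  have ckl : ∀ l, l ≠ i → l ≠ j → tr k l c = c := by
    intro l hli hlj
    by_cases hkl : k = l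
    · rw [hkl, tr_self]
    · exact h.tr_rootProduct_sub_of_disjoint hik (Ne.symm hli) hjk (Ne.symm hlj) hkl
  obtain ⟨b, hb⟩ : ∃ b, c - tr j k c = C b := by
    refine exists_eq_C_of_forall_tr_eq i fun l => ?_
    have h2 : c - tr j k c = tr j k c' - c' := by
      have := h.rootProduct_sub_tr hij hik hjk
      simp only [hc, hc', map_sub, map_mul, map_one, tr_yv_left hjk, tr_yv_right hjk,
        tr_yv_of_ne hij hik]
      linear_combination this
    have hk : tr i k (c - tr j k c) = c - tr j k c := by
      rw [h2, map_sub, tr_comm, cik]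
    by_cases hli : l = i
    · rw [hli, tr_self]
    · by_cases hlj : l = j
      · rw [hlj, map_sub, tr_comm, cij]
      · refine tr_trans_eq hk ?_
        rw [map_sub, tr_comm, ckl l hli hlj]
  obtain ⟨κ, hκ⟩ : ∃ κ, c - C b * (yv i + yv j) = C κ := by
    refine exists_eq_C_of_forall_tr_eq j fun l => ?_
    by_cases hlj : l = j
    · rw [hlj, tr_self]
    · by_cases hli : l = i
      · rw [hli, map_sub, tr_symm_eq cij, map_mul, tr_C, map_add, tr_yv_left (Ne.symm hij),
          tr_yv_right (Ne.symm hij)]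
        ring
      · refine tr_trans_eq (j := k) ?_ ?_
        · rw [map_sub, map_mul, tr_C, map_add, tr_yv_left hjk, tr_yv_of_ne hij hik]
          linear_combination -hb
        · by_cases hkl : k = l
          · rw [hkl, tr_self]
          · rw [map_sub, map_mul, tr_C, map_add, ckl l hli hlj, tr_yv_of_ne hik (Ne.symm hli),
              tr_yv_of_ne hjk (Ne.symm hlj)]
  refine ⟨-b, κ, ?_⟩
  rw [C_neg]
  linear_combination hκ

/-- The polynomial by which `e_{ij} e_{ji}` acts, in rank at least two. -/
theorem ShiftRelations.exists_rootProduct_of_two_le (hn : 2 ≤ n) :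
    ∃ a : ℂ, ∀ i j, i ≠ j → rootProduct P i j = (yv i - 1 - C a) * (yv j - C a) := by
  have h1 : ∀ i j : Fin (n + 1), ∃ a κ : ℂ, i ≠ j →
      rootProduct P i j = (yv i - 1) * yv j - C a * (yv i + yv j) + C κ := by
    intro i j
    by_cases hij : i = j
    · exact ⟨0, 0, fun h => absurd hij h⟩
    · obtain ⟨k, hik, hjk⟩ := exists_ne_ne hn i j
      obtain ⟨a, κ, hR⟩ := h.exists_rootProduct_eq hij hik hjk
      exact ⟨a, κ, fun _ => hR⟩
  choose A K hR using h1
  -- the two constants `A i j` and `K i j` are compared by means of the relations for triples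
  have hg : ∀ i j k, i ≠ j → i ≠ k → j ≠ k →
      rootProduct P i j - tr j k (rootProduct P i j) = yv i - 1 - C (A i j) := by
    intro i j k hij hik hjk
    rw [hR i j hij]
    simp only [map_sub, map_add, map_mul, map_one, tr_C, tr_yv_left hjk, tr_yv_of_ne hij hik]
    ring
  have hg' : ∀ i j k, i ≠ j → i ≠ k → j ≠ k →
      tr j k (rootProduct P i k) - rootProduct P i k = yv i - 1 - C (A i k) := by
    intro i j k hij hik hjk
    rw [hR i k hik]
    simp only [map_sub, map_add, map_mul, map_one, tr_C, tr_yv_right hjk, tr_yv_of_ne hij hik]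
    ring
  have hA1 : ∀ i j k, i ≠ j → i ≠ k → A i j = A i k := by
    intro i j k hij hik
    by_cases hjk : j = k
    · rw [hjk]
    · have := (hg i j k hij hik hjk).symm.trans
        ((h.rootProduct_sub_tr hij hik hjk).trans (hg' i j k hij hik hjk))
      exact C_injective _ _ (sub_right_injective this)
  have hA2 : ∀ i j, i ≠ j → A i j = A j i := by
    intro i j hij
    obtain ⟨k, hik, hjk⟩ := exists_ne_ne hn i j
    have h2 := tr_rootProduct (P := P) i j
    rw [hR i j hij, hR j i (Ne.symm hij)] at h2
    have h3 := congrArg (tr j k) h2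
    simp only [map_sub, map_add, map_mul, map_one, tr_C, tr_tr, tr_yv_left (Ne.symm hij),
      tr_yv_right (Ne.symm hij), tr_yv_left hjk, tr_yv_of_ne hij hik] at h2 h3
    have h4 : C (A i j) = (C (A j i) : MvPolynomial (Fin n) ℂ) := by
      linear_combination h3 - h2
    exact C_injective _ _ h4
  have hA3 : ∀ i j k l, i ≠ j → k ≠ l → A i j = A k l := by
    intro i j k l hij hkl
    by_cases hik : i = k
    · subst hik; exact hA1 i j l hij hkl
    · rw [hA1 i j k hij hik, hA2 i k hik, hA1 k i l (Ne.symm hik) hkl]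
  let i₀ : Fin (n + 1) := 0
  obtain ⟨j₀, hij₀, -⟩ := exists_ne_ne hn i₀ i₀
  set a := A i₀ j₀ with ha
  -- it remains to show that the defect `κ` vanishes
  set κ : Fin (n + 1) → Fin (n + 1) → ℂ := fun i j => K i j - a - a ^ 2 with hκ
  have hR' : ∀ i j, i ≠ j →
      rootProduct P i j = (yv i - 1 - C a) * (yv j - C a) + C (κ i j) := by
    intro i j hij
    rw [hR i j hij, hA3 i j i₀ j₀ hij hij₀, ← ha]
    simp only [hκ, map_sub, map_pow]
    ring
  refine ⟨a, fun i j hij => ?_⟩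
  obtain ⟨k, hik, hjk⟩ := exists_ne_ne hn i j
  have hK := h.tr_rootProduct_mul hij hik hjk
  rw [hg i j k hij hik hjk, hA3 i j i₀ j₀ hij hij₀, ← ha, hR' i j hij, hR' i k hik, hR' j k hjk] at hK
  simp only [map_sub, map_add, map_mul, map_one, tr_C, tr_yv_left hjk, tr_yv_of_ne hij hik] at hK
  -- here `x` and `y` are the values of `h_i - 1 - a` and `h_j - 1 - a`, at points where only `h_i`,
  -- `h_j` and `h_k` may be nonzero
  have hev : ∀ x y : ℂ, (x * y + κ i j) * (x * (-(x + y) - 3 * a - 2) + κ i k)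
      = x ^ 2 * (y * (-(x + y) - 3 * a - 2) + κ j k) := by
    intro x y
    obtain ⟨p, hi, hj, hk⟩ := exists_eval_yv_triple hij hik hjk (x + 1 + a) (y + 1 + a)
    have := congrArg (eval p) hK
    simp only [map_sub, map_add, map_mul, map_one, map_pow, eval_C, hi, hj, hk] at this
    linear_combination this
  have e1 := hev 0 0
  have e2 := hev 1 0
  have e3 := hev 1 1
  have h5 : κ i j = 0 := by
    have : κ i k = κ i j := by linear_combination e3 - e2
    rw [this] at e1
    have : κ i j ^ 2 = 0 := by linear_combination e1
    exact pow_eq_zero_iff (two_ne_zero) |>.1 this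
  rw [hR' i j hij, h5, C_0, add_zero]

end Relations

/-- The polynomial by which `e_{ij} e_{ji}` acts. -/
theorem ShiftRelations.exists_rootProduct
    {P : Fin (n + 1) → Fin (n + 1) → MvPolynomial (Fin n) ℂ} (h : ShiftRelations P) :
    ∃ a : ℂ, ∀ i j, i ≠ j → rootProduct P i j = (yv i - 1 - C a) * (yv j - C a) := by
  obtain hn | rfl | rfl : 2 ≤ n ∨ n = 1 ∨ n = 0 := by omega
  · exact h.exists_rootProduct_of_two_le hn
  · have h01 : (0 : Fin 2) ≠ 1 := by decide
    obtain ⟨c, hc⟩ := exists_eq_C_of_forall_tr_eq (0 : Fin 2)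
      (f := rootProduct P 0 1 - (yv 0 - 1) * yv 1) (fun l => by
        fin_cases l
        · exact tr_self _ _
        · exact h.tr_rootProduct_sub h01)
    obtain ⟨s, hs⟩ := IsAlgClosed.exists_pow_nat_eq (1 + 4 * c) (n := 2) (by norm_num)
    -- `a` is a root of `a ^ 2 + a = c`
    obtain ⟨a, ha⟩ : ∃ a : ℂ, c = a ^ 2 + a := ⟨(s - 1) / 2, by linear_combination -hs / 4⟩
    have hy : (yv 1 : MvPolynomial (Fin 1) ℂ) = -yv 0 := by
      have h1 : (1 : Fin 2) = Fin.last 1 := rfl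
      have h0 : (0 : Fin 2) = Fin.castSucc 0 := rfl
      rw [h1, h0, yv_last, yv_castSucc, Fin.sum_univ_one]
    have hR : rootProduct P 0 1 = (yv 0 - 1 - C a) * (yv 1 - C a) := by
      rw [sub_eq_iff_eq_add.1 hc, ha, hy, map_add, map_pow]
      ring
    refine ⟨a, fun i j hij => ?_⟩
    fin_cases i <;> fin_cases j
    · exact absurd rfl hij
    · exact hR
    · have := h.rootProduct_sub h01
      change rootProduct P 1 0 = (yv 1 - 1 - C a) * (yv 0 - C a)
      rw [hR] at this
      linear_combination -this
    · exact absurd rfl hij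
  · exact ⟨0, fun i j hij => absurd (Fin.ext (by omega)) hij⟩

/-! ### Factorization of the root vectors -/

theorem totalDegree_yv_le (i : Fin (n + 1)) : (yv i : MvPolynomial (Fin n) ℂ).totalDegree ≤ 1 := by
  refine Fin.lastCases ?_ (fun i => ?_) i
  · rw [yv_last, totalDegree_neg]
    exact totalDegree_finsetSum_le fun i _ => (totalDegree_X i).le
  · rw [yv_castSucc, totalDegree_X]

theorem prime_yv_sub_C {i j : Fin (n + 1)} (hij : i ≠ j) (c : ℂ) :
    Prime (yv i - C c : MvPolynomial (Fin n) ℂ) := by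
  have hne : ∀ r : ℂ, (yv i - C c : MvPolynomial (Fin n) ℂ) ≠ C r := by
    intro r hr
    obtain ⟨p, hp, -⟩ := exists_eval_yv_pair hij (c + r + 1)
    have := congrArg (eval p) hr
    simp only [map_sub, hp, eval_C] at this
    exact one_ne_zero (α := ℂ) (by linear_combination this)
  refine (irreducible_of_totalDegree_eq_one ?_ fun x hx => ?_).prime
  · refine le_antisymm ((totalDegree_sub_C_le _ _).trans (totalDegree_yv_le i)) ?_
    rw [Nat.one_le_iff_ne_zero]
    intro h0
    exact hne _ (totalDegree_eq_zero_iff_eq_C.1 h0)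
  · refine isUnit_iff_ne_zero.2 ?_
    rintro rfl
    refine hne 0 ?_
    rw [C_0]
    ext m
    simpa using hx m

/-- The possible factors `1` and `h_i - a - 1` of the polynomial `e_{ij} · 1`. -/
def pf (a : ℂ) (e : Bool) (i : Fin (n + 1)) : MvPolynomial (Fin n) ℂ :=
  if e then yv i - 1 - C a else 1

/-- The possible factors `h_j - a` and `1` of the polynomial `e_{ij} · 1`. -/
def qf (a : ℂ) (e : Bool) (j : Fin (n + 1)) : MvPolynomial (Fin n) ℂ :=
  if e then 1 else yv j - C a

theorem eval_pf_ne_zero {a : ℂ} {i : Fin (n + 1)} {p : Fin n → ℂ} (h : eval p (yv i) ≠ 1 + a)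
    (e : Bool) : eval p (pf a e i) ≠ 0 := by
  cases e
  · simp [pf]
  · simpa [pf, sub_sub] using sub_ne_zero.2 h

theorem eval_qf_ne_zero {a : ℂ} {i : Fin (n + 1)} {p : Fin n → ℂ} (h : eval p (yv i) ≠ a)
    (e : Bool) : eval p (qf a e i) ≠ 0 := by
  cases e
  · simpa [qf] using sub_ne_zero.2 h
  · simp [qf]

theorem pf_ne_zero {i j : Fin (n + 1)} (hij : i ≠ j) (a : ℂ) (e : Bool) :
    (pf a e i : MvPolynomial (Fin n) ℂ) ≠ 0 := by
  obtain ⟨p, hp, -⟩ := exists_eval_yv_pair hij (2 + a)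
  intro h
  refine eval_pf_ne_zero (p := p) (a := a) (i := i) ?_ e (by rw [h, map_zero])
  rw [hp]
  intro h2
  exact one_ne_zero (α := ℂ) (by linear_combination h2)

theorem qf_ne_zero {i j : Fin (n + 1)} (hij : i ≠ j) (a : ℂ) (e : Bool) :
    (qf a e i : MvPolynomial (Fin n) ℂ) ≠ 0 := by
  obtain ⟨p, hp, -⟩ := exists_eval_yv_pair hij (1 + a)
  intro h
  refine eval_qf_ne_zero (p := p) (a := a) (i := i) ?_ e (by rw [h, map_zero])
  rw [hp]
  intro h2
  exact one_ne_zero (α := ℂ) (by linear_combination h2)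

theorem tr_pf_of_ne {i j k : Fin (n + 1)} (hi : k ≠ i) (hj : k ≠ j) (a : ℂ) (e : Bool) :
    tr i j (pf a e k) = pf a e k := by
  cases e <;> simp [pf, tr_C, tr_yv_of_ne hi hj]

theorem pf_mul_tr_qf {i j : Fin (n + 1)} (hij : i ≠ j) (a : ℂ) (e : Bool) :
    pf a e i * tr i j (qf a e i) = yv i - 1 - C a := by
  cases e <;> simp [pf, qf, tr_C, tr_yv_left hij]

/-- A factorization of a product of two primes into two factors. -/
theorem exists_unit_of_mul_eq_mul {R : Type*} [CommRing R] [IsDomain R] {p q A B : R} (hp : Prime p)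
    (hq : Prime q) (h : A * B = p * q) :
    ∃ (u : Rˣ) (e f : Bool), A = u * (if e then p else 1) * (if f then q else 1) ∧
      B = (u⁻¹ : Rˣ) * (if e then 1 else p) * (if f then 1 else q) := by
  have hpA : ∀ A B : R, A * B = p * q → p ∣ A → ∃ (u : Rˣ) (f : Bool),
      A = u * p * (if f then q else 1) ∧ B = (u⁻¹ : Rˣ) * (if f then 1 else q) := by
    rintro _ B h ⟨A, rfl⟩
    have h1 : q = A * B := mul_left_cancel₀ hp.ne_zero (by rw [← h, mul_assoc])
    obtain ⟨u, rfl⟩ | ⟨u, rfl⟩ := hq.irreducible.isUnit_or_isUnit h1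
    · exact ⟨u, false, by simp [mul_comm], by simp [h1]⟩
    · refine ⟨u⁻¹, true, ?_, by simp⟩
      rw [if_pos rfl, h1]
      linear_combination (-(p * A)) * u.mul_inv
  obtain hA | hB := hp.dvd_or_dvd (h ▸ dvd_mul_right p q)
  · obtain ⟨u, f, h1, h2⟩ := hpA A B h hA
    exact ⟨u, true, f, by simpa using h1, by simpa using h2⟩
  · obtain ⟨u, f, h1, h2⟩ := hpA B A (by rw [mul_comm, h]) hB
    refine ⟨u⁻¹, false, !f, ?_, ?_⟩
    · cases f <;> simpa using h2
    · cases f <;> simpa using h1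

theorem exists_ne_and_ne (u v : ℂ) : ∃ t : ℂ, t ≠ u ∧ t ≠ v := by
  obtain ⟨t, ht⟩ := Infinite.exists_notMem_finset ({u, v} : Finset ℂ)
  exact ⟨t, by simpa using ht⟩

section Relations

variable {P : Fin (n + 1) → Fin (n + 1) → MvPolynomial (Fin n) ℂ} (h : ShiftRelations P) {a : ℂ}
  (ha : ∀ i j, i ≠ j → rootProduct P i j = (yv i - 1 - C a) * (yv j - C a))

include ha

theorem exists_factorization {i j : Fin (n + 1)} (hij : i ≠ j) :
    ∃ (c : ℂˣ) (e f : Bool), P i j = C (c : ℂ) * pf a e i * qf a f j ∧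
      P j i = C ((c⁻¹ : ℂˣ) : ℂ) * pf a f j * qf a e i := by
  have hp : Prime (yv i - 1 - C a : MvPolynomial (Fin n) ℂ) := by
    have := prime_yv_sub_C hij (1 + a)
    rwa [C_add, C_1, ← sub_sub] at this
  have hq : Prime (yv j - C a : MvPolynomial (Fin n) ℂ) := prime_yv_sub_C (Ne.symm hij) a
  obtain ⟨u, e, f, h1, h2⟩ := exists_unit_of_mul_eq_mul hp hq (ha i j hij)
  obtain ⟨c, hc, hcu⟩ := isUnit_iff_eq_C_of_isReduced.1 u.isUnit
  obtain ⟨c, rfl⟩ := hc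
  have hcu' : ((u⁻¹ : (MvPolynomial (Fin n) ℂ)ˣ) : MvPolynomial (Fin n) ℂ)
      = C ((c⁻¹ : ℂˣ) : ℂ) := by
    refine Units.inv_eq_of_mul_eq_one_right ?_
    rw [hcu, ← C_mul, Units.mul_inv, C_1]
  refine ⟨c, e, !f, ?_, ?_⟩
  · rw [h1, hcu]
    cases e <;> cases f <;> simp [pf, qf]
  · apply tr_injective i j
    rw [h2, hcu']
    cases e <;> cases f <;>
      simp [pf, qf, tr_C, tr_yv_left hij, tr_yv_right hij] <;> ring

include h

/-- In rank at least two, whether `h_i - a - 1` divides `e_{ij} · 1` does not depend on `j`, because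
of the relation `e_{ik} e_{ji} = (h_i - a - 1) e_{jk}`. -/
theorem ShiftRelations.exists_parameters_of_two_le (hn : 2 ≤ n) :
    ∃ (ε : Fin (n + 1) → Bool) (b : Fin (n + 1) → ℂˣ), ∀ i j, i ≠ j →
      P i j = C ((b i : ℂ) / (b j : ℂ)) * pf a (ε i) i * qf a (ε j) j := by
  have h1 : ∀ i j, ∃ (c : ℂˣ) (e f : Bool), i ≠ j → P i j = C (c : ℂ) * pf a e i * qf a f j ∧
      P j i = C ((c⁻¹ : ℂˣ) : ℂ) * pf a f j * qf a e i := by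
    intro i j
    by_cases hij : i = j
    · exact ⟨1, true, true, fun h => absurd hij h⟩
    · obtain ⟨c, e, f, h⟩ := exists_factorization ha hij
      exact ⟨c, e, f, fun _ => h⟩
  choose c e f hP using h1
  have hrel : ∀ i j k, i ≠ j → i ≠ k → j ≠ k →
      P i k * tr i k (P j i) = (yv i - 1 - C a) * P j k := by
    intro i j k hij hik hjk
    rw [h.mul_tr_eq hij hik hjk, ha i j hij]
    simp only [map_sub, map_mul, map_one, tr_C, tr_yv_left hjk, tr_yv_of_ne hij hik]
    ring
  have he : ∀ i j k, i ≠ j → i ≠ k → j ≠ k → e i k = e i j := by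
    intro i j k hij hik hjk
    have h2 := hrel i j k hij hik hjk
    rw [(hP i k hik).1, (hP i j hij).2, (hP j k hjk).1, map_mul, map_mul, tr_C,
      tr_pf_of_ne (Ne.symm hij) hjk] at h2
    -- a zero of `h_i - a - 1` at which the other possible factors do not vanish
    obtain ⟨t, ht1, ht2⟩ := exists_ne_and_ne (1 + a) (-1 - 2 * a)
    obtain ⟨p, hi, hj, hk⟩ := exists_eval_yv_triple hij hik hjk (1 + a) t
    have hj' : eval p (yv j) ≠ 1 + a := by rwa [hj]
    have hk' : eval p (yv k) ≠ a := by
      rw [hk]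
      intro h3
      exact ht2 (by linear_combination -h3)
    have hz : eval p (yv i - 1 - C a) = 0 := by
      rw [map_sub, map_sub, map_one, eval_C, hi]
      ring
    have hl : (yv i - 1 - C a : MvPolynomial (Fin n) ℂ) ≠ 0 := pf_ne_zero hij a true
    have n1 := eval_pf_ne_zero hj' (f i j)
    have n2 := eval_pf_ne_zero hj' (e j k)
    have n3 := eval_qf_ne_zero hk' (f i k)
    have n4 := eval_qf_ne_zero hk' (f j k)
    have n5 := (c i k).ne_zero
    have n6 := (c j k).ne_zero
    have n7 := ((c i j)⁻¹).ne_zero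
    cases h4 : e i k <;> cases h5 : e i j
    · rfl
    · rw [h4, h5] at h2
      have h6 : C (c i k : ℂ) * qf a (f i k) k * (C (((c i j)⁻¹ : ℂˣ) : ℂ) * pf a (f i j) j)
          = (yv i - 1 - C a) * (C (c j k : ℂ) * pf a (e j k) j * qf a (f j k) k) := by
        rw [← h2]
        simp only [pf, qf, if_true, if_false, map_one, Bool.false_eq_true]
        ring
      have h7 := congrArg (eval p) h6
      rw [map_mul (eval p) (yv i - 1 - C a), hz, zero_mul] at h7
      simp only [map_mul, eval_C] at h7
      exact absurd h7 (mul_ne_zero (mul_ne_zero n5 n3) (mul_ne_zero n7 n1))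
    · rw [h4, h5] at h2
      have h6 : C (c i k : ℂ) * qf a (f i k) k * (C (((c i j)⁻¹ : ℂˣ) : ℂ) * pf a (f i j) j)
          * (yv i - 1 - C a) = C (c j k : ℂ) * pf a (e j k) j * qf a (f j k) k := by
        refine mul_left_cancel₀ hl (Eq.trans ?_ h2)
        simp only [pf, qf, if_true, if_false, map_sub, tr_C, tr_yv_left hik, Bool.false_eq_true]
        ring
      have h7 := congrArg (eval p) h6
      rw [map_mul (eval p) _ (yv i - 1 - C a), hz, mul_zero] at h7
      simp only [map_mul, eval_C] at h7
      exact absurd h7.symm (mul_ne_zero (mul_ne_zero n6 n2) n4)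
    · rfl
  have he' : ∀ i, ∃ ε, ∀ j, i ≠ j → e i j = ε := by
    intro i
    obtain ⟨k, hik, -⟩ := exists_ne_ne hn i i
    refine ⟨e i k, fun j hij => ?_⟩
    by_cases hjk : j = k
    · rw [hjk]
    · exact he i k j hik hij (Ne.symm hjk)
  choose ε hε using he'
  have hf : ∀ i j, i ≠ j → f i j = ε j := by
    intro i j hij
    have h2 := (hP i j hij).1.symm.trans (hP j i (Ne.symm hij)).2
    rw [hε i j hij, hε j i (Ne.symm hij)] at h2
    obtain ⟨k, hik, hjk⟩ := exists_ne_ne hn i j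
    -- a zero of `h_j - a` at which `h_i - a - 1` does not vanish
    obtain ⟨t, ht, -⟩ := exists_ne_and_ne (1 + a) 0
    obtain ⟨p, hi, hj, -⟩ := exists_eval_yv_triple hij hik hjk t a
    have hi' : eval p (yv i) ≠ 1 + a := by rwa [hi]
    have n1 := eval_pf_ne_zero hi' (ε i)
    have n2 := eval_pf_ne_zero hi' (f j i)
    have n3 := (c i j).ne_zero
    have n4 := ((c j i)⁻¹).ne_zero
    have hz : eval p (qf a false j) = 0 := by simp [qf, hj]
    have h3 := congrArg (eval p) h2
    cases h4 : f i j <;> cases h5 : ε j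
    · rfl
    · rw [h4, h5, map_mul _ _ (qf a false j), hz, mul_zero] at h3
      simp only [map_mul, eval_C, qf, if_true, map_one, mul_one] at h3
      exact absurd h3.symm (mul_ne_zero n4 n2)
    · rw [h4, h5, map_mul _ _ (qf a false j), hz, mul_zero] at h3
      simp only [map_mul, eval_C, qf, if_true, map_one, mul_one] at h3
      exact absurd h3 (mul_ne_zero n3 n1)
    · rfl
  have hP' : ∀ i j, i ≠ j → P i j = C (c i j : ℂ) * pf a (ε i) i * qf a (ε j) j := by
    intro i j hij
    rw [(hP i j hij).1, hε i j hij, hf i j hij]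
  have hinv : ∀ i j, i ≠ j → c j i = (c i j)⁻¹ := by
    intro i j hij
    have h2 := (hP i j hij).2
    rw [hP' j i (Ne.symm hij), hε i j hij, hf i j hij] at h2
    have h3 := mul_right_cancel₀ (pf_ne_zero (Ne.symm hij) a _)
      (mul_right_cancel₀ (qf_ne_zero hij a _) h2)
    exact Units.ext (C_injective _ _ h3)
  have hmul : ∀ i j k, i ≠ j → i ≠ k → j ≠ k → c i k * c j i = c j k := by
    intro i j k hij hik hjk
    have h2 := hrel i j k hij hik hjk
    rw [hP' i k hik, hP' j i (Ne.symm hij), hP' j k hjk, map_mul, map_mul, tr_C,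
      tr_pf_of_ne (Ne.symm hij) hjk, ← pf_mul_tr_qf hik a (ε i)] at h2
    have n1 : pf a (ε i) i * tr i k (qf a (ε i) i) ≠ 0 := by
      rw [pf_mul_tr_qf hik]
      exact pf_ne_zero hij a true
    have h3 : (C (c i k : ℂ) * C (c j i : ℂ) : MvPolynomial (Fin n) ℂ) = C (c j k : ℂ) := by
      refine mul_right_cancel₀ (pf_ne_zero (Ne.symm hij) a (ε j))
        (mul_right_cancel₀ (qf_ne_zero (Ne.symm hik) a (ε k)) (mul_right_cancel₀ n1 ?_))
      linear_combination h2
    rw [← C_mul] at h3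
    exact Units.ext (by simpa using C_injective _ _ h3)
  -- the multiplicative relations between the scalars give `c i j = c i (n+1) / c j (n+1)`
  refine ⟨ε, fun i => if i = Fin.last n then 1 else c i (Fin.last n), fun i j hij => ?_⟩
  rw [hP' i j hij]
  congr 3
  rw [← Units.val_div_eq_div_val]
  congr 1
  beta_reduce
  by_cases hi : i = Fin.last n
  · subst hi
    rw [if_pos rfl, if_neg (Ne.symm hij), hinv j _ (Ne.symm hij), one_div]
  · by_cases hj : j = Fin.last n
    · subst hj
      rw [if_pos rfl, if_neg hi, div_one]
    · rw [if_neg hi, if_neg hj, ← hmul _ i j (Ne.symm hi) (Ne.symm hj) hij, hinv j _ hj]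
      rw [mul_comm, div_eq_mul_inv]

theorem ShiftRelations.exists_parameters :
    ∃ (ε : Fin (n + 1) → Bool) (b : Fin (n + 1) → ℂˣ), ∀ i j, i ≠ j →
      P i j = C ((b i : ℂ) / (b j : ℂ)) * pf a (ε i) i * qf a (ε j) j := by
  obtain hn | rfl | rfl : 2 ≤ n ∨ n = 1 ∨ n = 0 := by omega
  · exact h.exists_parameters_of_two_le ha hn
  · obtain ⟨c, e, f, h1, h2⟩ := exists_factorization ha (show (0 : Fin 2) ≠ 1 by decide)
    refine ⟨![e, f], ![c, 1], fun i j hij => ?_⟩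
    fin_cases i <;> fin_cases j
    · exact absurd rfl hij
    · simpa using h1
    · simpa using h2
    · exact absurd rfl hij
  · exact ⟨fun _ => true, fun _ => 1, fun i j hij => absurd (Fin.ext (by omega)) hij⟩

end Relations

/-! ### Recognition of the modules of Nilsson -/

theorem IsPolynomialRep.ext {ρ ρ' : LieRep (Sl n) (MvPolynomial (Fin n) ℂ)}
    (hρ : IsPolynomialRep ρ) (hρ' : IsPolynomialRep ρ')
    (h : ∀ i j, i ≠ j → ρ (el i j) 1 = ρ' (el i j) 1) : ρ = ρ' := by
  refine rep_ext fun i j => LinearMap.ext fun f => ?_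
  by_cases hij : i = j
  · subst hij
    rw [hρ, hρ']
  · rw [hρ.apply_el, hρ'.apply_el, h i j hij]

theorem IsPolynomialRep.comp_phi {ρ : LieRep (Sl n) (MvPolynomial (Fin n) ℂ)}
    (hρ : IsPolynomialRep ρ) (b : Fin (n + 1) → ℂˣ) : IsPolynomialRep (ρ.comp (phi b)) := by
  intro i f
  rw [LieHom.comp_apply, phi_el, div_self (b i).ne_zero, one_smul, hρ]

theorem isPolynomialRep_nilssonModule (S : Finset (Fin n)) (a : ℂ) :
    IsPolynomialRep (nilssonModule S a) := by
  have h : ∀ (i : Fin n) f, nilssonModule S a (el i.castSucc i.castSucc) f = X i * f := by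
    intro i f
    rw [nilssonModule, slHom_el, fullGen, Fin.lastCases_castSucc, Fin.lastCases_castSucc, nilssonX,
      if_pos rfl, LinearMap.mulLeft_apply]
  intro i f
  refine Fin.lastCases ?_ (fun i => ?_) i
  · rw [el_last_last, map_neg, map_sum, yv_last, LinearMap.neg_apply, LinearMap.sum_apply]
    simp only [h, neg_mul, Finset.sum_mul]
  · rw [h, yv_castSucc]

/-- The type of the index `i` in the module `M_a^S`: whether the factor `h_i - a - 1` occurs in the
polynomials `e_{ij} · 1`. -/
def nilssonType (S : Finset (Fin n)) (i : Fin (n + 1)) : Bool :=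
  Fin.lastCases false (fun i => decide (i ∉ S)) i

/-- The signs `-1, …, -1, 1` by which `M_a^S` differs from the form that is symmetric in all
indices. -/
def nilssonSign (i : Fin (n + 1)) : ℂˣ := Fin.lastCases 1 (fun _ => -1) i

theorem nilssonModule_el_one (S : Finset (Fin n)) (a : ℂ) {i j : Fin (n + 1)} (hij : i ≠ j) :
    nilssonModule S a (el i j) 1 = C ((nilssonSign i : ℂ) / (nilssonSign j : ℂ)) *
      pf a (nilssonType S i) i * qf a (nilssonType S j) j := by
  rw [nilssonModule, slHom_el]
  revert hij
  refine Fin.lastCases ?_ (fun i => ?_) i <;> refine Fin.lastCases ?_ (fun j => ?_) j <;> intro hij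
  · exact absurd rfl hij
  · simp only [fullGen, nilssonL, nilssonType, nilssonSign, Fin.lastCases_castSucc,
      Fin.lastCases_last, pf, qf, Module.End.mul_apply, AlgHom.toLinearMap_apply, map_one,
      LinearMap.mulLeft_apply, yv_castSucc]
    by_cases hj : j ∈ S <;> simp [hj, div_neg]
  · simp only [fullGen, nilssonU, nilssonType, nilssonSign, Fin.lastCases_castSucc,
      Fin.lastCases_last, pf, qf, Module.End.mul_apply, AlgHom.toLinearMap_apply, map_one,
      LinearMap.mulLeft_apply, yv_castSucc, yv_last]
    by_cases hi : i ∈ S <;> simp [hi] <;> ring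
  · have hij' : i ≠ j := fun h => hij (congrArg _ h)
    simp only [fullGen, nilssonX, if_neg hij', nilssonType, nilssonSign, Fin.lastCases_castSucc,
      pf, qf, Module.End.mul_apply, AlgHom.toLinearMap_apply, map_one,
      LinearMap.mulLeft_apply, yv_castSucc]
    by_cases hi : i ∈ S <;> by_cases hj : j ∈ S <;>
      simp [hi, hj, -mul_eq_mul_right_iff, -mul_eq_mul_left_iff] <;> ring

theorem IsPolynomialRep.exists_eq_nilsson {ρ : LieRep (Sl n) (MvPolynomial (Fin n) ℂ)}
    (hρ : IsPolynomialRep ρ) {a : ℂ} {ε : Fin (n + 1) → Bool} {b : Fin (n + 1) → ℂˣ}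
    (hε : ε (Fin.last n) = false)
    (h : ∀ i j, i ≠ j →
      ρ (el i j) 1 = C ((b i : ℂ) / (b j : ℂ)) * pf a (ε i) i * qf a (ε j) j) :
    ∃ (S : Finset (Fin n)) (b' : Fin (n + 1) → ℂˣ), ρ = (nilssonModule S a).comp (phi b') := by
  let S : Finset (Fin n) := Finset.univ.filter fun i => ε i.castSucc = false
  have hS : nilssonType S = ε := by
    funext i
    refine Fin.lastCases ?_ (fun i => ?_) i
    · simp [nilssonType, hε]
    · simp [nilssonType, S]
  refine ⟨S, fun i => b i / nilssonSign i, hρ.ext ((isPolynomialRep_nilssonModule S a).comp_phi _) ?_⟩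
  intro i j hij
  rw [LieHom.comp_apply, phi_el, map_smul, LinearMap.smul_apply, nilssonModule_el_one S a hij, hS,
    h i j hij, smul_eq_C_mul, ← mul_assoc, ← mul_assoc, ← C_mul]
  congr 4
  have h1 := (nilssonSign i).ne_zero
  have h2 := (nilssonSign j).ne_zero
  have h3 := (b j).ne_zero
  rw [Units.val_div_eq_div_val, Units.val_div_eq_div_val]
  field_simp

/-! ### The twist by the negative transpose -/

/-- The automorphism of `ℂ[h_1, …, h_n]` that changes the sign of every variable. -/
def negVars (n : ℕ) : MvPolynomial (Fin n) ℂ ≃ₐ[ℂ] MvPolynomial (Fin n) ℂ :=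
  AlgEquiv.ofAlgHom (aeval fun k => -X k) (aeval fun k => -X k)
    (MvPolynomial.algHom_ext fun k => by simp) (MvPolynomial.algHom_ext fun k => by simp)

theorem negVars_C (c : ℂ) : negVars n (C c) = C c := (negVars n).commutes c

theorem negVars_yv (i : Fin (n + 1)) : negVars n (yv i) = -yv i := by
  have h : ∀ k, negVars n (X k) = -X k := fun k => aeval_X _ _
  refine Fin.lastCases ?_ (fun i => ?_) i
  · simp [yv_last, h]
  · rw [yv_castSucc, h]

theorem negVars_pf (a : ℂ) (e : Bool) (i : Fin (n + 1)) :
    negVars n (pf a e i) = C (if e then -1 else 1) * qf (-1 - a) (!e) i := by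
  cases e <;> simp [pf, qf, negVars_yv, negVars_C]
  ring

theorem negVars_qf (a : ℂ) (e : Bool) (i : Fin (n + 1)) :
    negVars n (qf a e i) = C (if e then 1 else -1) * pf (-1 - a) (!e) i := by
  cases e <;> simp [pf, qf, negVars_yv, negVars_C]
  ring

/-- The twist by `τ` of a representation on `ℂ[h_1, …, h_n]`, with the sign of the variables changed
so that the Cartan subalgebra again acts by multiplication. -/
def tauTwist (ρ : LieRep (Sl n) (MvPolynomial (Fin n) ℂ)) :
    LieRep (Sl n) (MvPolynomial (Fin n) ℂ) :=
  conjRep (ρ.comp (tau n)) (negVars n).toLinearEquiv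

theorem tauTwist_el (ρ : LieRep (Sl n) (MvPolynomial (Fin n) ℂ)) (i j : Fin (n + 1))
    (f : MvPolynomial (Fin n) ℂ) :
    tauTwist ρ (el i j) f = -negVars n (ρ (el j i) (negVars n f)) := by
  rw [tauTwist, conjRep_apply, LieHom.comp_apply, tau_el, map_neg, LinearMap.neg_apply, map_neg]
  rfl

theorem IsPolynomialRep.tauTwist {ρ : LieRep (Sl n) (MvPolynomial (Fin n) ℂ)}
    (hρ : IsPolynomialRep ρ) : IsPolynomialRep (tauTwist ρ) := by
  intro i f
  have h : negVars n (negVars n f) = f := (negVars n).symm_apply_apply f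
  rw [tauTwist_el, hρ, map_mul, negVars_yv, h, neg_mul, neg_neg]

/-- The twist by `τ` exchanges the two types of indices. -/
theorem tauTwist_el_one {ρ : LieRep (Sl n) (MvPolynomial (Fin n) ℂ)} {a : ℂ}
    {ε : Fin (n + 1) → Bool} {b : Fin (n + 1) → ℂˣ}
    (h : ∀ i j, i ≠ j →
      ρ (el i j) 1 = C ((b i : ℂ) / (b j : ℂ)) * pf a (ε i) i * qf a (ε j) j)
    (i j : Fin (n + 1)) (hij : i ≠ j) :
    tauTwist ρ (el i j) 1 = C ((((if ε i then -1 else 1) / b i : ℂˣ) : ℂ) /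
      (((if ε j then -1 else 1) / b j : ℂˣ) : ℂ)) * pf (-1 - a) (!ε i) i * qf (-1 - a) (!ε j) j := by
  rw [tauTwist_el, map_one, h j i (Ne.symm hij), map_mul, map_mul, negVars_C, negVars_pf,
    negVars_qf]
  have h1 := (b i).ne_zero
  have h2 := (b j).ne_zero
  have h3 : (((if ε i then -1 else 1) / b i : ℂˣ) : ℂ) / (((if ε j then -1 else 1) / b j : ℂˣ) : ℂ)
      = -((b j : ℂ) / (b i : ℂ) * (if ε j then -1 else 1) * (if ε i then 1 else -1)) := by
    cases ε i <;> cases ε j <;> simp <;> field_simp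
  rw [h3]
  simp only [C_neg, C_mul]
  ring

/-! ### Cyclic modules over the Weyl algebra -/

theorem eq_C_of_pderiv_eq_zero {f : MvPolynomial (Fin n) ℂ} (h : ∀ i, pderiv i f = 0) :
    f = C (coeff 0 f) := by
  ext m
  rw [coeff_C]
  split_ifs with hm
  · rw [hm]
  · obtain ⟨i, hi⟩ : ∃ i, m i ≠ 0 := by
      by_contra! h0
      exact hm (Finsupp.ext fun i => (h0 i).symm)
    have h1 := coeff_pderiv (i := i) f (m - Finsupp.single i 1)
    have h2 : m - Finsupp.single i 1 + Finsupp.single i 1 = m :=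
      tsub_add_cancel_of_le (Finsupp.single_le_iff.2 (Nat.one_le_iff_ne_zero.2 hi))
    rw [h i, coeff_zero, h2] at h1
    exact (mul_eq_zero.1 h1.symm).resolve_right (Nat.cast_add_one_ne_zero _)

theorem totalDegree_pderiv_le {f : MvPolynomial (Fin n) ℂ} {d : ℕ} (h : f.totalDegree ≤ d + 1)
    (i : Fin n) : (pderiv i f).totalDegree ≤ d := by
  refine Finset.sup_le fun m hm => ?_
  rw [mem_support_iff, coeff_pderiv] at hm
  have h1 := (le_totalDegree (mem_support_iff.2 (left_ne_zero_of_mul hm))).trans h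
  rw [Finsupp.sum_add_index' (fun _ => rfl) (fun _ _ _ => rfl), Finsupp.sum_single_index rfl] at h1
  omega

/-- The module `ℂ[t_1, …, t_n]` over the Weyl algebra is simple: a nonzero subspace that is stable
under the derivatives contains the constants. -/
theorem eq_bot_of_pderiv_mem {K : Submodule ℂ (MvPolynomial (Fin n) ℂ)}
    (hK : ∀ i, ∀ f ∈ K, pderiv i f ∈ K) (h1 : (1 : MvPolynomial (Fin n) ℂ) ∉ K) : K = ⊥ := by
  have hC : ∀ c : ℂ, C c ∈ K → c = 0 := by
    intro c hc
    by_contra h0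
    have := K.smul_mem c⁻¹ hc
    rw [smul_eq_C_mul, ← C_mul, inv_mul_cancel₀ h0, C_1] at this
    exact h1 this
  have key : ∀ d : ℕ, ∀ f ∈ K, f.totalDegree ≤ d → f = 0 := by
    intro d
    induction d with
    | zero =>
      intro f hf hd
      rw [totalDegree_eq_zero_iff_eq_C.1 (Nat.le_zero.1 hd)] at hf ⊢
      rw [hC _ hf, C_0]
    | succ d ih =>
      intro f hf hd
      have h2 := eq_C_of_pderiv_eq_zero fun i => ih _ (hK i f hf) (totalDegree_pderiv_le hd i)
      rw [h2] at hf ⊢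
      rw [hC _ hf, C_0]
  exact (Submodule.eq_bot_iff K).2 fun f hf => key _ f hf le_rfl

/-- A module over the Weyl algebra that is generated by a nonzero common eigenvector of the
derivatives, with eigenvalues `c`, is the exponential module `e^{ct} ℂ[t_1, …, t_n]`. -/
theorem WeylModule.exists_equiv_exp {P : Type*} [AddCommGroup P] [Module ℂ P] (Q : WeylModule n P)
    (c : Fin n → ℂ) (v : P) (hv : v ≠ 0) (hd : ∀ i, Q.d i v = c i • v)
    (hgen : ∀ W : Submodule ℂ P, v ∈ W →
      (∀ i, ∀ w ∈ W, Q.t i w ∈ W) → (∀ i, ∀ w ∈ W, Q.d i w ∈ W) → W = ⊤) :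
    ∃ e : MvPolynomial (Fin n) ℂ ≃ₗ[ℂ] P,
      (∀ i f, e (((polynomialModule n).exp c).t i f) = Q.t i (e f)) ∧
      (∀ i f, e (((polynomialModule n).exp c).d i f) = Q.d i (e f)) := by
  obtain ⟨φ, hφ⟩ := exists_aeval_of_commute Q.t fun i j => sub_eq_zero.1 (Q.relations.tt i j)
  let g : MvPolynomial (Fin n) ℂ →ₗ[ℂ] P := (LinearMap.applyₗ v).comp φ.toLinearMap
  have hg : ∀ f, g f = φ f v := fun f => rfl
  have hg1 : g 1 = v := by rw [hg, map_one, Module.End.one_apply]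
  have hgt : ∀ i f, g (X i * f) = Q.t i (g f) := by
    intro i f
    rw [hg, map_mul, hφ, Module.End.mul_apply, hg]
  have hgd : ∀ i f, g (pderiv i f + c i • f) = Q.d i (g f) := by
    intro i f
    induction f using MvPolynomial.induction_on with
    | C a =>
      have : (C a : MvPolynomial (Fin n) ℂ) = a • 1 := by rw [smul_eq_C_mul, mul_one]
      rw [pderiv_C, zero_add, map_smul, this, map_smul, hg1, map_smul, hd, smul_comm]
    | add p q hp hq =>
      have h1 : pderiv i (p + q) + c i • (p + q)
          = (pderiv i p + c i • p) + (pderiv i q + c i • q) := by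
        rw [map_add, smul_add]
        abel
      rw [h1, map_add, hp, hq, map_add, map_add]
    | mul_X p j hp =>
      have h1 : Q.d i (Q.t j (g p)) = Q.t j (Q.d i (g p)) + if i = j then g p else 0 := by
        have h2 := LinearMap.congr_fun (Q.relations.dt i j) (g p)
        rw [Ring.lie_def, LinearMap.sub_apply, Module.End.mul_apply, Module.End.mul_apply,
          sub_eq_iff_eq_add'] at h2
        rw [h2]
        split_ifs <;> rfl
      rw [mul_comm p, hgt, h1, ← hp, ← hgt, Derivation.leibniz, pderiv_X]
      have h3 : (if i = j then g p else 0) = g (if i = j then p else 0) := by split_ifs <;> simp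
      rw [h3, ← map_add]
      congr 1
      by_cases hij : i = j
      · subst hij
        simp only [Pi.single_eq_same, if_true, smul_eq_mul, mul_one, smul_eq_C_mul]
        ring
      · simp only [Pi.single_eq_of_ne (Ne.symm hij), if_neg hij, smul_eq_mul, mul_zero,
          smul_eq_C_mul]
        ring
  have hker : LinearMap.ker g = ⊥ := by
    refine eq_bot_of_pderiv_mem (fun i f hf => ?_) ?_
    · rw [LinearMap.mem_ker] at hf ⊢
      have := hgd i f
      rwa [map_add, map_smul, hf, smul_zero, add_zero, map_zero] at this
    · rw [LinearMap.mem_ker, hg1]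
      exact hv
  have hrange : LinearMap.range g = ⊤ := by
    refine hgen _ ⟨1, hg1⟩ ?_ ?_
    · rintro i _ ⟨f, rfl⟩
      exact ⟨X i * f, hgt i f⟩
    · rintro i _ ⟨f, rfl⟩
      exact ⟨_, hgd i f⟩
  have hbij : Function.Bijective g := ⟨LinearMap.ker_eq_bot.1 hker, LinearMap.range_eq_top.1 hrange⟩
  exact ⟨LinearEquiv.ofBijective g hbij, fun i f => hgt i f, fun i f => hgd i f⟩

/-! ### A realization of exponential modules by shift operators -/

theorem shift_X (i k : Fin n) (c : ℂ) : shift i c (X k) = X k + C (if k = i then c else 0) := by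
  rw [shift, aeval_X]
  split_ifs <;> simp

theorem shift_C (i : Fin n) (c r : ℂ) : shift i c (C r) = C r := (shift i c).commutes r

/-- For `η i = ± 1`, the operators `t_i = -(η_i / c_i) (h_i - κ_i) s_i` and `∂_i = c_i s_i⁻¹` on
`ℂ[h_1, …, h_n]`, where `s_i` is the translation `h_i ↦ h_i + η_i`. -/
def shiftWeyl (c κ : Fin n → ℂ) (η : Fin n → ℤˣ) (hc : ∀ i, c i ≠ 0) :
    WeylModule n (MvPolynomial (Fin n) ℂ) where
  t i := LinearMap.mulLeft ℂ (C (-(η i : ℤ) * (c i)⁻¹) * (X i - C (κ i))) *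
    (shift i (η i : ℤ)).toLinearMap
  d i := LinearMap.mulLeft ℂ (C (c i)) * (shift i (-(η i : ℤ))).toLinearMap
  relations := by
    refine ⟨fun i j => ?_, fun i j => ?_, fun i j => ?_⟩
    · by_cases hij : i = j
      · rw [hij, lie_self]
      · refine LinearMap.ext fun f => ?_
        simp only [Ring.lie_def, LinearMap.sub_apply, Module.End.mul_apply, LinearMap.zero_apply,
          LinearMap.mulLeft_apply, AlgHom.toLinearMap_apply, map_mul, map_sub, shift_X, shift_C,
          shift_comm j i, if_neg hij, if_neg (Ne.symm hij), C_0, add_zero]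
        ring
    · refine LinearMap.ext fun f => ?_
      simp only [Ring.lie_def, LinearMap.sub_apply, Module.End.mul_apply, LinearMap.zero_apply,
        LinearMap.mulLeft_apply, AlgHom.toLinearMap_apply, map_mul, shift_C, shift_comm j i]
      ring
    · refine LinearMap.ext fun f => ?_
      simp only [Ring.lie_def, LinearMap.sub_apply, Module.End.mul_apply,
        LinearMap.mulLeft_apply, AlgHom.toLinearMap_apply, map_mul, map_sub, shift_X, shift_C]
      by_cases hij : i = j
      · subst hij
        have h1 : shift i (-((η i : ℤ) : ℂ)) (shift i ((η i : ℤ) : ℂ) f) = f := by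
          simpa using shift_neg i (-((η i : ℤ) : ℂ)) f
        have h2 : ((η i : ℤ) : ℂ) * ((η i : ℤ) : ℂ) = 1 := by
          rw [← Int.cast_mul, ← Units.val_mul, Int.units_mul_self, Units.val_one, Int.cast_one]
        have h3 : (C (((η i : ℤ) : ℂ) * ((η i : ℤ) : ℂ)) : MvPolynomial (Fin n) ℂ) = 1 := by
          rw [h2, C_1]
        have h4 : (C (c i * (c i)⁻¹) : MvPolynomial (Fin n) ℂ) = 1 := by
          rw [mul_inv_cancel₀ (hc i), C_1]
        rw [h1, shift_neg, if_pos rfl, if_pos rfl, Module.End.one_apply]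
        simp only [C_mul, C_neg] at h3 h4 ⊢
        linear_combination f * C (c i) * C (c i)⁻¹ * h3 + f * h4
      · rw [shift_comm j i, if_neg hij, if_neg (Ne.symm hij)]
        simp only [C_0, add_zero, LinearMap.zero_apply]
        ring

theorem shiftWeyl_t_apply (c κ : Fin n → ℂ) (η : Fin n → ℤˣ) (hc : ∀ i, c i ≠ 0) (i : Fin n)
    (f : MvPolynomial (Fin n) ℂ) : (shiftWeyl c κ η hc).t i f
      = C (-(η i : ℤ) * (c i)⁻¹) * (X i - C (κ i)) * shift i (η i : ℤ) f := rfl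

theorem shiftWeyl_d_apply (c κ : Fin n → ℂ) (η : Fin n → ℤˣ) (hc : ∀ i, c i ≠ 0) (i : Fin n)
    (f : MvPolynomial (Fin n) ℂ) : (shiftWeyl c κ η hc).d i f
      = C (c i) * shift i (-(η i : ℤ)) f := rfl

theorem shiftWeyl_t_d (c κ : Fin n → ℂ) (η : Fin n → ℤˣ) (hc : ∀ i, c i ≠ 0) (i : Fin n)
    (f : MvPolynomial (Fin n) ℂ) : (shiftWeyl c κ η hc).t i ((shiftWeyl c κ η hc).d i f)
      = -C ((η i : ℤ) : ℂ) * (X i - C (κ i)) * f := by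
  have h4 : (C ((c i)⁻¹ * c i) : MvPolynomial (Fin n) ℂ) = 1 := by
    rw [inv_mul_cancel₀ (hc i), C_1]
  rw [shiftWeyl_t_apply, shiftWeyl_d_apply, map_mul (shift i _), shift_C, shift_neg]
  simp only [C_mul, C_neg] at h4 ⊢
  linear_combination -(C ((η i : ℤ) : ℂ)) * (X i - C (κ i)) * f * h4

theorem shiftWeyl_exists_equiv (c κ : Fin n → ℂ) (η : Fin n → ℤˣ) (hc : ∀ i, c i ≠ 0) :
    ∃ e : MvPolynomial (Fin n) ℂ ≃ₗ[ℂ] MvPolynomial (Fin n) ℂ,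
      (∀ i f, e (((polynomialModule n).exp c).t i f) = (shiftWeyl c κ η hc).t i (e f)) ∧
      (∀ i f, e (((polynomialModule n).exp c).d i f) = (shiftWeyl c κ η hc).d i (e f)) := by
  refine WeylModule.exists_equiv_exp _ c 1 one_ne_zero (fun i => ?_) fun W h1 ht hd => ?_
  · rw [shiftWeyl_d_apply, map_one, mul_one, smul_eq_C_mul, mul_one]
  · -- the multiplication by `h_i` is a polynomial in `t_i ∂_i`
    have hX : ∀ i, ∀ f ∈ W, X i * f ∈ W := by
      intro i f hf
      have h2 := W.smul_mem (-((η i : ℤ) : ℂ)) (ht i _ (hd i f hf))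
      rw [shiftWeyl_t_d] at h2
      have h3 := W.add_mem h2 (W.smul_mem (κ i) hf)
      have h4 : (C ((η i : ℤ) : ℂ) * C ((η i : ℤ) : ℂ) : MvPolynomial (Fin n) ℂ) = 1 := by
        rw [← C_mul, ← Int.cast_mul, ← Units.val_mul, Int.units_mul_self, Units.val_one,
          Int.cast_one, C_1]
      convert h3 using 1
      simp only [smul_eq_C_mul, C_neg]
      linear_combination -(X i - C (κ i)) * f * h4
    refine Submodule.eq_top_iff'.2 fun f => ?_
    induction f using MvPolynomial.induction_on with
    | C a =>
      have := W.smul_mem a h1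
      rwa [smul_eq_C_mul, mul_one] at this
    | add p q hp hq => exact W.add_mem hp hq
    | mul_X p i hp => rw [mul_comm]; exact hX i p hp

/-! ### Tensor modules with one-dimensional second factor -/

/-- The action of the elementary matrices of `gl(n)` on `V_a`, as scalar operators. -/
def scalarGl {n : ℕ} (R : Type*) [Ring R] [Algebra ℂ R] (a : ℂ) (i j : Fin n) : R :=
  if i = j then algebraMap ℂ R a else 0

section Transport

variable {P P' : Type*} [AddCommGroup P] [Module ℂ P] [AddCommGroup P'] [Module ℂ P']

theorem WeylModule.fourier_equiv {Q : WeylModule n P} {Q' : WeylModule n P'} (e : P ≃ₗ[ℂ] P')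
    (ht : ∀ i f, e (Q.t i f) = Q'.t i (e f)) (hd : ∀ i f, e (Q.d i f) = Q'.d i (e f))
    (S : Finset (Fin n)) :
    (∀ i f, e ((Q.fourier S).t i f) = (Q'.fourier S).t i (e f)) ∧
      (∀ i f, e ((Q.fourier S).d i f) = (Q'.fourier S).d i (e f)) := by
  refine ⟨fun i f => ?_, fun i f => ?_⟩ <;> simp only [WeylModule.fourier] <;> split_ifs
  · exact hd i f
  · exact ht i f
  · rw [LinearMap.neg_apply, map_neg, ht, LinearMap.neg_apply]
  · exact hd i f

/-- The module `T(P, V_a)` is realized on the space `P`, up to an isomorphism of Weyl modules. -/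
theorem exists_tensorModule_equiv {Q : WeylModule n P} {Q' : WeylModule n P'} (e : P ≃ₗ[ℂ] P')
    (ht : ∀ i f, e (Q.t i f) = Q'.t i (e f)) (hd : ∀ i f, e (Q.d i f) = Q'.d i (e f)) (a : ℂ) :
    ∃ ρ : LieRep (Sl n) P', Isomorphic (tensorModule Q (traceRep n a)) ρ ∧
      (∀ i j, ρ (el i.castSucc j.castSucc) = tensorX Q'.t Q'.d (scalarGl _ a) i j) ∧
      (∀ i, ρ (el i.castSucc (Fin.last n)) = tensorU Q'.t Q'.d (scalarGl _ a) i) ∧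
      (∀ j, ρ (el (Fin.last n) j.castSucc) = tensorL Q'.t j) := by
  let Φ : P ⊗[ℂ] ℂ ≃ₗ[ℂ] P' := (TensorProduct.rid ℂ P).trans e
  let f : Module.End ℂ (P ⊗[ℂ] ℂ) ≃ₐ[ℂ] Module.End ℂ P' := Φ.conjAlgEquiv ℂ
  have hf : ∀ (x : Module.End ℂ (P ⊗[ℂ] ℂ)) (y : Module.End ℂ P'),
      (∀ p : P, Φ (x (p ⊗ₜ 1)) = y (e p)) → f x = y := by
    intro x y h
    refine LinearMap.ext fun m => ?_
    obtain ⟨p, rfl⟩ := e.surjective m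
    change Φ (x (Φ.symm (e p))) = _
    have : Φ.symm (e p) = p ⊗ₜ 1 := by
      rw [LinearEquiv.symm_apply_eq]
      simp [Φ]
    rw [this, h]
  have hft : ∀ i, f ((Q.t i).rTensor ℂ) = Q'.t i := fun i => hf _ _ fun p => by simp [Φ, ht]
  have hfd : ∀ i, f ((Q.d i).rTensor ℂ) = Q'.d i := fun i => hf _ _ fun p => by simp [Φ, hd]
  have hfE : ∀ i j, f ((traceRep n a (Matrix.single i j 1)).lTensor P)
      = scalarGl (Module.End ℂ P') a i j := by
    intro i j
    refine hf _ _ fun p => ?_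
    have h1 : traceRep n a (Matrix.single i j 1) (1 : ℂ) = if i = j then a else 0 := by
      change (algebraMap ℂ (Module.End ℂ ℂ) (a * (Matrix.single i j (1 : ℂ)).trace)) 1 = _
      by_cases hij : i = j
      · subst hij; simp
      · simp [hij]
    rw [LinearMap.lTensor_tmul, h1, scalarGl]
    by_cases hij : i = j <;> simp [hij, Φ]
  refine ⟨conjRep (tensorModule Q (traceRep n a)) Φ, isomorphic_conjRep _ _,
    fun i j => ?_, fun i => ?_, fun j => ?_⟩
  · change f (tensorModule Q (traceRep n a) (el i.castSucc j.castSucc)) = _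
    rw [tensorModule, slHom_el, fullGen, Fin.lastCases_castSucc, Fin.lastCases_castSucc]
    simp only [tensorX, map_sub, map_mul, hft, hfd, hfE]
    split_ifs <;> simp
  · change f (tensorModule Q (traceRep n a) (el i.castSucc (Fin.last n))) = _
    rw [tensorModule, slHom_el, fullGen, Fin.lastCases_castSucc, Fin.lastCases_last]
    simp only [tensorU, map_sub, map_add, map_neg, map_sum, map_mul, hft, hfd, hfE, map_natCast,
      map_one]
  · change f (tensorModule Q (traceRep n a) (el (Fin.last n) j.castSucc)) = _
    rw [tensorModule, slHom_el, fullGen, Fin.lastCases_last, Fin.lastCases_castSucc]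
    simp only [tensorL, map_neg, hft]

end Transport

theorem nilssonParameter_ne_zero (S : Finset (Fin n)) (b : Fin (n + 1) → ℂˣ) (i : Fin n) :
    nilssonParameter S b i ≠ 0 := by
  rw [nilssonParameter]
  split_ifs
  · exact neg_ne_zero.2 (div_ne_zero (b _).ne_zero (b _).ne_zero)
  · exact div_ne_zero (b _).ne_zero (b _).ne_zero

/-- The Weyl module on `ℂ[h_1, …, h_n]` that underlies the module `F_b M_a^S`. -/
def nilssonWeyl (S : Finset (Fin n)) (a : ℂ) (b : Fin (n + 1) → ℂˣ) :
    WeylModule n (MvPolynomial (Fin n) ℂ) :=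
  (shiftWeyl (nilssonParameter S b) (fun i => if i ∈ S then a else a + 1)
    (fun i => if i ∈ S then 1 else -1) (nilssonParameter_ne_zero S b)).fourier Sᶜ

theorem nilssonWeyl_t_apply (S : Finset (Fin n)) (a : ℂ) (b : Fin (n + 1) → ℂˣ) (j : Fin n)
    (f : MvPolynomial (Fin n) ℂ) : (nilssonWeyl S a b).t j f
      = C ((b (Fin.last n) : ℂ) / b j.castSucc) * qf a (nilssonType S j.castSucc) j.castSucc *
        shift j 1 f := by
  by_cases hj : j ∈ S
  · have h1 : (nilssonWeyl S a b).t j = (shiftWeyl (nilssonParameter S b)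
        (fun i => if i ∈ S then a else a + 1) (fun i => if i ∈ S then 1 else -1)
        (nilssonParameter_ne_zero S b)).t j := by
      simp [nilssonWeyl, WeylModule.fourier, hj]
    rw [h1, shiftWeyl_t_apply]
    simp [nilssonParameter, nilssonType, qf, hj, yv_castSucc]
  · have h1 : (nilssonWeyl S a b).t j = (shiftWeyl (nilssonParameter S b)
        (fun i => if i ∈ S then a else a + 1) (fun i => if i ∈ S then 1 else -1)
        (nilssonParameter_ne_zero S b)).d j := by
      simp [nilssonWeyl, WeylModule.fourier, hj]
    rw [h1, shiftWeyl_d_apply]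
    simp [nilssonParameter, nilssonType, qf, hj]

theorem nilssonWeyl_d_one (S : Finset (Fin n)) (a : ℂ) (b : Fin (n + 1) → ℂˣ) (i : Fin n) :
    (nilssonWeyl S a b).d i 1 = -(C ((b i.castSucc : ℂ) / b (Fin.last n)) *
      pf a (nilssonType S i.castSucc) i.castSucc) := by
  by_cases hi : i ∈ S
  · have h1 : (nilssonWeyl S a b).d i = (shiftWeyl (nilssonParameter S b)
        (fun i => if i ∈ S then a else a + 1) (fun i => if i ∈ S then 1 else -1)
        (nilssonParameter_ne_zero S b)).d i := by
      simp [nilssonWeyl, WeylModule.fourier, hi]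
    rw [h1, shiftWeyl_d_apply]
    simp [nilssonParameter, nilssonType, pf, hi]
  · have h1 : (nilssonWeyl S a b).d i = -(shiftWeyl (nilssonParameter S b)
        (fun i => if i ∈ S then a else a + 1) (fun i => if i ∈ S then 1 else -1)
        (nilssonParameter_ne_zero S b)).t i := by
      simp [nilssonWeyl, WeylModule.fourier, hi]
    rw [h1, LinearMap.neg_apply, shiftWeyl_t_apply]
    simp [nilssonParameter, nilssonType, pf, hi, yv_castSucc]
    ring

theorem nilssonWeyl_t_d (S : Finset (Fin n)) (a : ℂ) (b : Fin (n + 1) → ℂˣ) (i : Fin n)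
    (f : MvPolynomial (Fin n) ℂ) :
    (nilssonWeyl S a b).t i ((nilssonWeyl S a b).d i f) = (C a - X i) * f := by
  set W := shiftWeyl (nilssonParameter S b) (fun i => if i ∈ S then a else a + 1)
    (fun i => if i ∈ S then 1 else -1) (nilssonParameter_ne_zero S b) with hW
  have h0 : W.t i (W.d i f) = _ := shiftWeyl_t_d _ _ _ _ i f
  by_cases hi : i ∈ S
  · have h1 : (nilssonWeyl S a b).t i = W.t i := by simp [nilssonWeyl, WeylModule.fourier, hi, hW]
    have h2 : (nilssonWeyl S a b).d i = W.d i := by simp [nilssonWeyl, WeylModule.fourier, hi, hW]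
    rw [h1, h2, h0]
    simp [hi]
  · have h1 : (nilssonWeyl S a b).t i = W.d i := by simp [nilssonWeyl, WeylModule.fourier, hi, hW]
    have h2 : (nilssonWeyl S a b).d i = -W.t i := by
      simp [nilssonWeyl, WeylModule.fourier, hi, hW]
    have h3 := LinearMap.congr_fun (W.relations.dt i i) f
    rw [Ring.lie_def, LinearMap.sub_apply, Module.End.mul_apply, Module.End.mul_apply, h0,
      if_pos rfl, Module.End.one_apply] at h3
    rw [h1, h2, LinearMap.neg_apply, map_neg, sub_eq_iff_eq_add.1 h3]
    simp [hi]
    ring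

/-- The module `F_b M_a^S` is an exponential tensor module. -/
theorem nilsson_isomorphic_expTensor (S : Finset (Fin n)) (a : ℂ) (b : Fin (n + 1) → ℂˣ) :
    Isomorphic ((nilssonModule S a).comp (phi b))
      (expTensorModule (nilssonParameter S b) (traceRep n (a + 1)) Sᶜ) := by
  obtain ⟨e, het, hed⟩ := shiftWeyl_exists_equiv (nilssonParameter S b)
    (fun i => if i ∈ S then a else a + 1) (fun i => if i ∈ S then 1 else -1)
    (nilssonParameter_ne_zero S b)
  obtain ⟨hft, hfd⟩ := WeylModule.fourier_equiv e het hed Sᶜ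
  obtain ⟨ρ, hρ, hX, hU, hL⟩ := exists_tensorModule_equiv e hft hfd (a + 1)
  change ∀ i j, _ = tensorX (nilssonWeyl S a b).t (nilssonWeyl S a b).d _ i j at hX
  change ∀ i, _ = tensorU (nilssonWeyl S a b).t (nilssonWeyl S a b).d _ i at hU
  change ∀ j, _ = tensorL (nilssonWeyl S a b).t j at hL
  have hXX : ∀ (i : Fin n) f, ρ (el i.castSucc i.castSucc) f = X i * f := by
    intro i f
    rw [hX]
    simp only [tensorX, scalarGl, if_true, LinearMap.sub_apply, Module.End.mul_apply,
      nilssonWeyl_t_d, Module.End.one_apply, Module.algebraMap_end_apply, smul_eq_C_mul, C_add,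
      C_1]
    ring
  have hpoly : IsPolynomialRep ρ := by
    intro i f
    refine Fin.lastCases ?_ (fun i => ?_) i
    · rw [el_last_last, map_neg, map_sum, yv_last, LinearMap.neg_apply, LinearMap.sum_apply]
      simp only [hXX, neg_mul, Finset.sum_mul]
    · rw [hXX, yv_castSucc]
  have heq : (nilssonModule S a).comp (phi b) = ρ := by
    refine ((isPolynomialRep_nilssonModule S a).comp_phi b).ext hpoly fun i j hij => ?_
    rw [LieHom.comp_apply, phi_el, map_smul, LinearMap.smul_apply, nilssonModule_el_one S a hij,
      smul_eq_C_mul]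
    revert hij
    refine Fin.lastCases ?_ (fun i => ?_) i <;> refine Fin.lastCases ?_ (fun j => ?_) j <;>
      intro hij
    · exact absurd rfl hij
    · rw [hL, tensorL, LinearMap.neg_apply, nilssonWeyl_t_apply, map_one]
      simp [nilssonSign, nilssonType, pf, div_neg]
    · have h1 : tensorU (nilssonWeyl S a b).t (nilssonWeyl S a b).d
          (scalarGl (Module.End ℂ (MvPolynomial (Fin n) ℂ)) (a + 1)) i
          = (∑ j, (nilssonWeyl S a b).t j * -(nilssonWeyl S a b).d j) * -(nilssonWeyl S a b).d i
            + algebraMap ℂ _ (n * a + a) * -(nilssonWeyl S a b).d i := by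
        rw [← tensorU_scalar]
        simp only [neg_neg]
        rfl
      rw [hU, h1]
      simp only [LinearMap.add_apply, Module.End.mul_apply, LinearMap.sum_apply,
        LinearMap.neg_apply, map_neg, nilssonWeyl_t_d, nilssonWeyl_d_one,
        Module.algebraMap_end_apply, smul_eq_C_mul]
      simp [nilssonSign, nilssonType, qf, yv_last, Finset.sum_sub_distrib, ← Finset.sum_mul]
      ring
    · have hij' : i ≠ j := fun h => hij (congrArg _ h)
      rw [hX, tensorX, scalarGl, if_neg hij', if_neg hij']
      simp only [zero_sub, sub_zero, LinearMap.neg_apply, Module.End.mul_apply, nilssonWeyl_d_one,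
        map_neg, nilssonWeyl_t_apply, mul_neg, neg_neg]
      have h2 : shift j 1 (pf a (nilssonType S i.castSucc) i.castSucc)
          = pf a (nilssonType S i.castSucc) i.castSucc := by
        cases nilssonType S i.castSucc <;>
          simp [pf, yv_castSucc, shift_X, shift_C, hij']
      have h3 : (b i.castSucc : ℂ) / b j.castSucc
          = (b (Fin.last n) : ℂ) / b j.castSucc * ((b i.castSucc : ℂ) / b (Fin.last n)) := by
        have := (b (Fin.last n)).ne_zero
        have := (b j.castSucc).ne_zero
        field_simp
      rw [map_mul, shift_C, h2, h3, C_mul]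
      simp [nilssonSign]
      ring
  rw [heq]
  exact hρ.symm

end HFree

end

theorem mainTheorem6 (n : ℕ) :
    (∀ (S : Finset (Fin n)) (a : ℂ) (b : Fin (n + 1) → ℂˣ),
      HFree.Isomorphic ((HFree.nilssonModule S a).comp (HFree.phi b))
        (HFree.expTensorModule (HFree.nilssonParameter S b) (HFree.traceRep n (a + 1)) Sᶜ)) ∧
    (∀ (M : Type*) [AddCommGroup M] [Module ℂ M] (ρ : HFree.LieRep (HFree.Sl n) M),
      HFree.IsHFreeOfRank 1 ρ →
        ∃ (b : Fin n → ℂˣ) (a : ℂ) (S : Finset (Fin n)),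
          HFree.Isomorphic ρ
            (HFree.expTensorModule (fun i => (b i : ℂ)) (HFree.traceRep n a) S) ∨
          HFree.Isomorphic ρ
            ((HFree.expTensorModule (fun i => (b i : ℂ)) (HFree.traceRep n a) S).comp
              (HFree.tau n))) := by
  refine ⟨HFree.nilsson_isomorphic_expTensor, fun M _ _ ρ hρ => ?_⟩
  obtain ⟨ρ₁, hpoly, hiso⟩ := hρ.exists_polynomialRep
  have hrel := hpoly.shiftRelations
  obtain ⟨a, ha⟩ := hrel.exists_rootProduct
  obtain ⟨ε, b, hP⟩ := hrel.exists_parameters ha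
  cases hε : ε (Fin.last n)
  · obtain ⟨S, b', rfl⟩ := hpoly.exists_eq_nilsson hε hP
    exact ⟨fun i => Units.mk0 _ (HFree.nilssonParameter_ne_zero S b' i), a + 1, Sᶜ,
      Or.inl (hiso.trans (HFree.nilsson_isomorphic_expTensor S a b'))⟩
  · obtain ⟨S, b', h⟩ := hpoly.tauTwist.exists_eq_nilsson
      (ε := fun i => !ε i) (by simp [hε]) (HFree.tauTwist_el_one hP)
    refine ⟨fun i => Units.mk0 _ (HFree.nilssonParameter_ne_zero S b' i), -1 - a + 1, Sᶜ, Or.inr ?_⟩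
    have h1 : HFree.Isomorphic (ρ.comp (HFree.tau n)) (HFree.tauTwist ρ₁) :=
      (hiso.comp (HFree.tau n)).trans (HFree.isomorphic_conjRep _ _)
    rw [h] at h1
    have h2 := (h1.trans (HFree.nilsson_isomorphic_expTensor S _ b')).comp (HFree.tau n)
    have h3 : (ρ.comp (HFree.tau n)).comp (HFree.tau n) = ρ :=
      LieHom.ext fun x => by rw [LieHom.comp_apply, LieHom.comp_apply, HFree.tau_tau]
    rwa [h3] at h2
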